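/- Conventions. For a nonempty finite set $A$, $\overline{\Omega}_A\mathbf S$ denotes the free profinite semigroup on $A$ (its elements are called pseudowords), and for a class $\mathbf V$ of finite semigroups closed under homomorphic images, subsemigroups and finite direct products (a pseudovariety) $p_{\mathbf V}:\overline{\Omega}_A\mathbf S\to\overline{\Omega}_A\mathbf V$ is the canonical projection onto the relatively free pro-$\mathbf V$ semigroup. A pseudovariety of groups is a pseudovariety all of whose members are groups. An implicit signature $\sigma$ is a set of pseudowords of finite arity containing the binary multiplication; $\Omega^\sigma_A\mathbf S$ is the $\sigma$-subalgebra of $\overline{\Omega}_A\mathbf S$ generated by $A$. The unary operation $\_^\omega$ assigns to an element $s$ of a finite semigroup the unique idempotent power of $s$. Graph reducibility. Let $\Gamma$ be a finite directed graph (loops and multiple edges allowed), $S$ a finite semigroup, $\varphi:\overline{\Omega}_A\mathbf S\to S$ an onto continuous homomorphism and $\psi:\Gamma\to S$ a function defined on all vertices and edges. A $\mathbf V$-solution of the system of equations $xy=z$ (one for each edge $x\xrightarrow{y}z$ of $\Gamma$) with constraints $\psi$ is a function $\gamma:\Gamma\to\overline{\Omega}_A\mathbf S$ with $\varphi(\gamma(x))=\psi(x)$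 for every vertex or edge $x$, and $p_{\mathbf V}(\gamma(x)\gamma(y))=p_{\mathbf V}(\gamma(z))$ for every edge $x\xrightarrow{y}z$. The pseudovariety $\mathbf V$ is graph $\sigma$-reducible if, for all $\Gamma,S,A,\varphi,\psi$ as above, whenever a $\mathbf V$-solution exists there is also one with values in $\Omega^\sigma_A\mathbf S$. Idempotent pointlike sets. A subset $P$ of a finite semigroup $S$ is $\mathbf V$-idempotent pointlike if, for every nonempty finite $A$ and every onto continuous homomorphism $\varphi:\overline{\Omega}_A\mathbf S\to S$, there is $P'\subseteq\overline{\Omega}_A\mathbf S$ such that $\varphi(P')=P$ and $p_{\mathbf V}(P')=\{e\}$ for some idempotent $e$. The pseudovariety $\mathbf V$ is $\sigma$-reducible for the idempotent pointlike problem if, for every $\mathbf V$-idempotent pointlike subset $P$ of a finite semigroup $S$ and every such $A$ and $\varphi$, the set $P'$ can be chosen to be a subset of $\Omega^\sigma_A\mathbf S$. Let $\overline{\mathbf H}$ be the class of all finite semigroups all of whose subgroups lie in $\mathbf H$, and let $\mathbf{DO}$ be the class of all finite semigroups in which every regular $\mathcal J$-class is an orthodox subsemigroup (equivalently, is the product of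 a rectangular band by a group). Corollary. Let $\mathbf H$ be a pseudovariety of groups and let $\sigma$ be an implicit signature. If $\mathbf H$ is graph $\sigma$-reducible, then $\mathbf{DO}\cap\overline{\mathbf H}$ is $\sigma\cup\{\_^\omega\}$-reducible for the idempotent pointlike problem. -/

import Mathlib

namespace Pseudo

/-! ### Classes of finite semigroups and pseudovarieties -/

/-- A class of finite semigroups (each finite semigroup has a copy in `Type`). -/
structure FinSemigroupClass where
  /-- membership of a semigroup in the class -/
  Mem : ∀ (S : Type) [Semigroup S], Prop
  finite_of_mem : ∀ (S : Type) [Semigroup S], Mem S → Finite S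

/-- A pseudovariety of semigroups: a class of finite semigroups closed under homomorphic images,
subsemigroups and finite direct products (`Unit` is the empty product). -/
structure FinSemigroupClass.IsPseudovariety (V : FinSemigroupClass) : Prop where
  image : ∀ (S T : Type) [Semigroup S] [Semigroup T] (f : S →ₙ* T),
    Function.Surjective f → V.Mem S → V.Mem T
  sub : ∀ (S T : Type) [Semigroup S] [Semigroup T] [Nonempty S] (f : S →ₙ* T),
    Function.Injective f → V.Mem T → V.Mem S
  unit : V.Mem Unit
  prod : ∀ (S T : Type) [Semigroup S] [Semigroup T], V.Mem S → V.Mem T → V.Mem (S × T)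

/-- The semigroup `S` is a group. -/
def IsGroupSemigroup (S : Type) [Semigroup S] : Prop :=
  ∃ (G : Type) (_ : Group G), Nonempty (S ≃* G)

/-- A pseudovariety of groups: a pseudovariety all of whose members are groups. -/
structure FinSemigroupClass.IsGroupPseudovariety (H : FinSemigroupClass) : Prop where
  isPseudovariety : H.IsPseudovariety
  isGroup : ∀ (S : Type) [Semigroup S], H.Mem S → IsGroupSemigroup S

/-- The pseudovariety `S` of all finite semigroups. -/
def allFinite : FinSemigroupClass where
  Mem S _ := Finite S
  finite_of_mem _ _ h := h

/-- The class `V ∩ W`. -/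
def FinSemigroupClass.inter (V W : FinSemigroupClass) : FinSemigroupClass where
  Mem S _ := V.Mem S ∧ W.Mem S
  finite_of_mem S _ h := V.finite_of_mem S h.1

/-- `H̄`: the finite semigroups all of whose subgroups (subsemigroups that are groups) lie
in `H`. -/
def FinSemigroupClass.bar (H : FinSemigroupClass) : FinSemigroupClass where
  Mem S _ := Finite S ∧ ∀ T : Subsemigroup S, IsGroupSemigroup T → H.Mem T
  finite_of_mem _ _ h := h.1

/-- Green's quasi-order `a ≤_J b`: `a ∈ S¹ b S¹`. -/
def JLE {S : Type} [Semigroup S] (a b : S) : Prop :=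
  ∃ x y : WithOne S, (a : WithOne S) = x * (b : WithOne S) * y

/-- Green's equivalence `J`. -/
def JEquiv {S : Type} [Semigroup S] (a b : S) : Prop := JLE a b ∧ JLE b a

/-- `a` is a regular element. -/
def IsRegularElem {S : Type} [Semigroup S] (a : S) : Prop := ∃ x : S, a * x * a = a

/-- `DO`: the finite semigroups in which each regular `J`-class is an orthodox subsemigroup
(equivalently, a product of a rectangular band by a group): it is closed under multiplication
and products of its idempotents are idempotent. -/
def classDO : FinSemigroupClass where
  Mem S _ := Finite S ∧ ∀ a : S, IsRegularElem a →
    (∀ x y : S, JEquiv x a → JEquiv y a → JEquiv (x * y) a) ∧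
    (∀ e f : S, JEquiv e a → JEquiv f a → IsIdempotentElem e → IsIdempotentElem f →
      IsIdempotentElem (e * f))
  finite_of_mem _ _ h := h.1

/-! ### Relatively free profinite semigroups -/

/-- The relatively free pro-`V` semigroup `Ω_A V`: the inverse limit of the quotients of the
free semigroup on `A` that belong to `V`, as a subsemigroup of their product. Compatibility of
a family `u`: every word representing `u c` represents `u d` for each coarser `d`. -/
def freePro (V : FinSemigroupClass) (A : Type) :
    Subsemigroup (∀ c : {c : Con (FreeSemigroup A) // V.Mem c.Quotient}, c.1.Quotient) where
  carrier := {u | ∀ c d, c.1 ≤ d.1 → ∀ w : FreeSemigroup A,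
    (w : c.1.Quotient) = u c → (w : d.1.Quotient) = u d}
  mul_mem' := by
    intro u v hu hv c d h w hw
    obtain ⟨a, ha⟩ := Quotient.exists_rep (u c)
    obtain ⟨b, hb⟩ := Quotient.exists_rep (v c)
    have ha' : (a : c.1.Quotient) = u c := ha
    have hb' : (b : c.1.Quotient) = v c := hb
    have h1 : (w : c.1.Quotient) = ((a * b : FreeSemigroup A) : c.1.Quotient) := by
      rw [hw, Con.coe_mul, ha', hb']; rfl
    have h2 : (w : d.1.Quotient) = ((a * b : FreeSemigroup A) : d.1.Quotient) :=
      (Con.eq d.1).2 (h ((Con.eq c.1).1 h1))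
    rw [h2, Con.coe_mul, hu c d h a ha', hv c d h b hb']; rfl

/-- The profinite topology: induced by the product of the discrete topologies. -/
instance freeProTopology (V : FinSemigroupClass) (A : Type) : TopologicalSpace (freePro V A) :=
  TopologicalSpace.induced Subtype.val (@Pi.topologicalSpace _ _ fun _ => ⊥)

/-- The free profinite semigroup `Ω_A S`; its elements are the pseudowords over `A`. -/
abbrev Pseudoword (A : Type) : Type := freePro allFinite A

/-- The canonical projection `p_V : Ω_A S → Ω_A V`. -/
def proj (V : FinSemigroupClass) (A : Type) : Pseudoword A →ₙ* freePro V A where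
  toFun u := ⟨fun c => u.1 ⟨c.1, V.finite_of_mem _ c.2⟩,
    fun c d h w hw => u.2 ⟨c.1, V.finite_of_mem _ c.2⟩ ⟨d.1, V.finite_of_mem _ d.2⟩ h w hw⟩
  map_mul' _ _ := rfl

/-- The free generator `a` of `Ω_A S`. -/
def letter {A : Type} (a : A) : Pseudoword A :=
  ⟨fun c => ((FreeSemigroup.of a : FreeSemigroup A) : c.1.Quotient), fun c d h _ hw =>
    (Con.eq d.1).2 (h ((Con.eq c.1).1 hw))⟩

theorem finite_ker {A S : Type} [Semigroup S] [Finite S] (f : A → S) :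
    Finite (Con.ker (FreeSemigroup.lift f)).Quotient := by
  refine Finite.of_injective
    (fun q => Con.liftOn q (FreeSemigroup.lift f) fun _ _ h => h) ?_
  intro p q
  induction p using Con.induction_on
  induction q using Con.induction_on
  intro h
  exact (Con.eq _).2 h

/-- The value of the pseudoword `u` in the finite semigroup `S` when its variables are given the
values `f`, i.e. the image of `u` under the continuous homomorphism `Ω_A S → S` extending `f`. -/
def evalAt {A S : Type} [Semigroup S] [Finite S] (u : Pseudoword A) (f : A → S) : S :=
  Con.liftOn (u.1 ⟨Con.ker (FreeSemigroup.lift f), finite_ker f⟩) (FreeSemigroup.lift f)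
    fun _ _ h => h

theorem evalAt_eq {A S : Type} [Semigroup S] [Finite S] (u : Pseudoword A) (f : A → S)
    (r : FreeSemigroup A) (hr : (r : (Con.ker (FreeSemigroup.lift f)).Quotient) =
      u.1 ⟨Con.ker (FreeSemigroup.lift f), finite_ker f⟩) :
    evalAt u f = FreeSemigroup.lift f r := by
  unfold evalAt
  rw [← hr]
  rfl

/-- The interpretation of implicit operations in `Ω_A S`: the pseudoword `u(w_1, …, w_n)`,
obtained from `u` by substituting `w i` for the variable `i`. -/
def subst {X A : Type} (u : Pseudoword X) (w : X → Pseudoword A) : Pseudoword A :=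
  ⟨fun c => @evalAt X c.1.Quotient _ c.2 u fun i => (w i).1 c, by
    intro c d h v hv
    have : Finite c.1.Quotient := c.2
    have : Finite d.1.Quotient := d.2
    have hx : ∀ i, ∃ x : FreeSemigroup A, (x : c.1.Quotient) = (w i).1 c :=
      fun i => Quotient.exists_rep _
    choose x hx using hx
    have key : ∀ (e : Con (FreeSemigroup A)) (r : FreeSemigroup X),
        FreeSemigroup.lift (fun i => ((x i : FreeSemigroup A) : e.Quotient)) r =
          ((FreeSemigroup.lift x r : FreeSemigroup A) : e.Quotient) := by
      intro e r
      induction r with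
      | ih1 i => simp
      | ih2 i r _ ih => rw [map_mul, map_mul, Con.coe_mul, ih]; simp
    have hc : (fun i => (w i).1 c) = fun i => ((x i : FreeSemigroup A) : c.1.Quotient) :=
      funext fun i => (hx i).symm
    have hd : (fun i => (w i).1 d) = fun i => ((x i : FreeSemigroup A) : d.1.Quotient) :=
      funext fun i => ((w i).2 c d h (x i) (hx i)).symm
    change (v : c.1.Quotient) = evalAt u (fun i => (w i).1 c) at hv
    change (v : d.1.Quotient) = evalAt u (fun i => (w i).1 d)
    rw [hc] at hv
    rw [hd]
    obtain ⟨r, hr⟩ : ∃ r : FreeSemigroup X, (r : Con.Quotient _) = u.1 ⟨Con.ker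
        (FreeSemigroup.lift fun i => ((x i : FreeSemigroup A) : c.1.Quotient)), finite_ker _⟩ :=
      Quotient.exists_rep _
    rw [evalAt_eq u _ r hr, key] at hv
    rw [evalAt_eq u _ r (u.2 _ ⟨Con.ker
      (FreeSemigroup.lift fun i => ((x i : FreeSemigroup A) : d.1.Quotient)), finite_ker _⟩
      ?_ r hr), key]
    · exact (Con.eq d.1).2 (h ((Con.eq c.1).1 hv))
    · intro a b hab
      have hab' : FreeSemigroup.lift (fun i => ((x i : FreeSemigroup A) : c.1.Quotient)) a =
        FreeSemigroup.lift (fun i => ((x i : FreeSemigroup A) : c.1.Quotient)) b := hab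
      change FreeSemigroup.lift (fun i => ((x i : FreeSemigroup A) : d.1.Quotient)) a =
        FreeSemigroup.lift (fun i => ((x i : FreeSemigroup A) : d.1.Quotient)) b
      rw [key, key] at hab' ⊢
      exact (Con.eq d.1).2 (h ((Con.eq c.1).1 hab'))⟩

/-! ### The `ω`-power -/

theorem exists_pow_of_mem_closure {S : Type} [Semigroup S] {s e : S}
    (he : e ∈ Subsemigroup.closure {s}) :
    ∃ k : ℕ, (e : WithOne S) = (s : WithOne S) ^ (k + 1) := by
  induction he using Subsemigroup.closure_induction with
  | mem x hx => exact ⟨0, by simp [Set.mem_singleton_iff.1 hx]⟩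
  | mul x y _ _ hx hy =>
    obtain ⟨k, hk⟩ := hx
    obtain ⟨l, hl⟩ := hy
    exact ⟨k + l + 1, by rw [WithOne.coe_mul, hk, hl, ← pow_add]; congr 1; ring⟩

theorem idempotent_power_unique {S : Type} [Semigroup S] {s e f : S}
    (he : e ∈ Subsemigroup.closure {s}) (hf : f ∈ Subsemigroup.closure {s})
    (hee : IsIdempotentElem e) (hff : IsIdempotentElem f) : e = f := by
  obtain ⟨k, hk⟩ := exists_pow_of_mem_closure he
  obtain ⟨l, hl⟩ := exists_pow_of_mem_closure hf
  have hee' : IsIdempotentElem (e : WithOne S) := by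
    unfold IsIdempotentElem; rw [← WithOne.coe_mul, hee.eq]
  have hff' : IsIdempotentElem (f : WithOne S) := by
    unfold IsIdempotentElem; rw [← WithOne.coe_mul, hff.eq]
  have h1 := hee'.pow_succ_eq l
  have h2 := hff'.pow_succ_eq k
  rw [hk, ← pow_mul] at h1
  rw [hl, ← pow_mul, mul_comm, h1] at h2
  exact WithOne.coe_injective (by rw [hk, hl, h2])

theorem exists_idempotent_power {S : Type} [Semigroup S] [Finite S] (s : S) :
    ∃ e ∈ Subsemigroup.closure {s}, IsIdempotentElem e := by
  let _ : TopologicalSpace S := ⊥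
  have : DiscreteTopology S := ⟨rfl⟩
  exact exists_idempotent_in_compact_subsemigroup (fun _ => continuous_of_discreteTopology)
    (Subsemigroup.closure {s} : Set S) ⟨s, Subsemigroup.subset_closure rfl⟩
    (Set.toFinite _).isCompact (fun x hx y hy => mul_mem hx hy)

/-- `s^ω`: the unique idempotent among the powers of the element `s` of a finite semigroup. -/
noncomputable def omegaPow {S : Type} [Semigroup S] [Finite S] (s : S) : S :=
  (exists_idempotent_power s).choose

/-- The unary pseudoword `x^ω`. -/
noncomputable def omegaWord : Pseudoword (Fin 1) :=
  ⟨fun c => @omegaPow c.1.Quotient _ c.2 ((letter (0 : Fin 1)).1 c), by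
    intro c d h v hv
    have : Finite c.1.Quotient := c.2
    have : Finite d.1.Quotient := d.2
    obtain ⟨hc1, hc2⟩ := (exists_idempotent_power ((letter (0 : Fin 1)).1 c)).choose_spec
    obtain ⟨hd1, hd2⟩ := (exists_idempotent_power ((letter (0 : Fin 1)).1 d)).choose_spec
    change (v : c.1.Quotient) = omegaPow ((letter (0 : Fin 1)).1 c) at hv
    change (v : d.1.Quotient) = omegaPow ((letter (0 : Fin 1)).1 d)
    refine idempotent_power_unique (s := (letter (0 : Fin 1)).1 d) ?_ hd1 ?_ hd2
    · have : ∀ q ∈ Subsemigroup.closure {(letter (0 : Fin 1)).1 c}, ∀ v : FreeSemigroup (Fin 1),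
          (v : c.1.Quotient) = q →
          (v : d.1.Quotient) ∈ Subsemigroup.closure {(letter (0 : Fin 1)).1 d} := by
        intro q hq
        induction hq using Subsemigroup.closure_induction with
        | mem q hq =>
          intro v hv
          rw [Set.mem_singleton_iff] at hq
          rw [hq] at hv
          exact Subsemigroup.subset_closure ((letter (0 : Fin 1)).2 c d h v hv)
        | mul p q _ _ hp hq =>
          intro v hv
          obtain ⟨a, rfl⟩ := Quotient.exists_rep p
          obtain ⟨b, rfl⟩ := Quotient.exists_rep q
          have : (v : d.1.Quotient) = ((a * b : FreeSemigroup (Fin 1)) : d.1.Quotient) :=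
            (Con.eq d.1).2 (h ((Con.eq c.1).1 hv))
          rw [this, Con.coe_mul]
          exact mul_mem (hp a rfl) (hq b rfl)
      exact this _ hc1 v hv
    · unfold IsIdempotentElem
      rw [← Con.coe_mul]
      refine (Con.eq d.1).2 (h ((Con.eq c.1).1 ?_))
      rw [Con.coe_mul, hv]
      exact hc2⟩

/-! ### Implicit signatures -/

/-- An implicit signature: a set of pseudowords of finite arity that contains the binary
multiplication `x_0 x_1`. (There are no pseudowords of arity `0`.) -/
structure ImplicitSignature where
  /-- the operations, with their arities -/
  ops : Set (Σ n : ℕ, Pseudoword (Fin n))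
  mul_mem : ⟨2, letter 0 * letter 1⟩ ∈ ops

/-- The signature `σ ∪ {_^ω}`. -/
noncomputable def ImplicitSignature.addOmega (σ : ImplicitSignature) : ImplicitSignature where
  ops := σ.ops ∪ {⟨1, omegaWord⟩}
  mul_mem := Or.inl σ.mul_mem

/-- `Ω^σ_A S`: the `σ`-subalgebra of `Ω_A S` generated by `A`. -/
inductive SigmaWord (σ : ImplicitSignature) (A : Type) : Pseudoword A → Prop
  | letter (a : A) : SigmaWord σ A (letter a)
  | op (n : ℕ) (u : Pseudoword (Fin n)) (hu : ⟨n, u⟩ ∈ σ.ops) (w : Fin n → Pseudoword A)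
      (hw : ∀ i, SigmaWord σ A (w i)) : SigmaWord σ A (subst u w)

/-! ### Idempotent pointlike sets -/

/-- The continuous homomorphisms from `Ω_A S` onto the finite (discrete) semigroup `S`. -/
structure OntoHom (A S : Type) [Semigroup S] where
  /-- the underlying homomorphism -/
  hom : Pseudoword A →ₙ* S
  continuous : @Continuous _ _ _ ⊥ hom
  surjective : Function.Surjective hom

/-- The set `P'` of pseudowords witnesses, with respect to `φ`, that `P` is `V`-idempotent
pointlike: `φ(P') = P` and `p_V(P')` is a singleton consisting of an idempotent. -/
def IsIdempotentPointlikeWitness (V : FinSemigroupClass) {A S : Type} [Semigroup S]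
    (φ : OntoHom A S) (P : Set S) (P' : Set (Pseudoword A)) : Prop :=
  φ.hom '' P' = P ∧ ∃ e : freePro V A, IsIdempotentElem e ∧ proj V A '' P' = {e}

/-- The subset `P` of `S` is `V`-idempotent pointlike. -/
def IsIdempotentPointlike (V : FinSemigroupClass) {S : Type} [Semigroup S] (P : Set S) : Prop :=
  ∀ (A : Type) [Finite A] [Nonempty A] (φ : OntoHom A S),
    ∃ P' : Set (Pseudoword A), IsIdempotentPointlikeWitness V φ P P'

/-- `V` is `σ`-reducible for the idempotent pointlike problem: the witnesses can always be
chosen inside `Ω^σ_A S`. -/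
def IdempotentPointlikeReducible (V : FinSemigroupClass) (σ : ImplicitSignature) : Prop :=
  ∀ (S : Type) [Semigroup S] [Finite S] (P : Set S), IsIdempotentPointlike V P →
    ∀ (A : Type) [Finite A] [Nonempty A] (φ : OntoHom A S),
      ∃ P' : Set (Pseudoword A), P' ⊆ {w | SigmaWord σ A w} ∧
        IsIdempotentPointlikeWitness V φ P P'

/-! ### Systems of graph equations -/

/-- A finite directed graph; loops and multiple edges are allowed. -/
structure FinDigraph where
  /-- the vertices -/
  Vert : Type
  /-- the edges -/
  Edge : Type
  [finVert : Finite Vert]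
  [finEdge : Finite Edge]
  /-- the beginning vertex of an edge -/
  src : Edge → Vert
  /-- the end vertex of an edge -/
  tgt : Edge → Vert

/-- `γ` is a `V`-solution of the system of equations `x y = z`, one for each edge `y` from `x` to
`z` of `Γ`, constrained by `ψ` with respect to `φ`. The variables are the vertices and edges. -/
def IsGraphSolution (V : FinSemigroupClass) (Γ : FinDigraph) {A S : Type} [Semigroup S]
    (φ : OntoHom A S) (ψ : Γ.Vert ⊕ Γ.Edge → S) (γ : Γ.Vert ⊕ Γ.Edge → Pseudoword A) : Prop :=
  (∀ x, φ.hom (γ x) = ψ x) ∧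
  ∀ y : Γ.Edge, proj V A (γ (.inl (Γ.src y)) * γ (.inr y)) = proj V A (γ (.inl (Γ.tgt y)))

/-- `V` is graph `σ`-reducible: every constrained system of equations associated with a finite
directed graph that has a `V`-solution has one with values in `Ω^σ_A S`. -/
def GraphReducible (V : FinSemigroupClass) (σ : ImplicitSignature) : Prop :=
  ∀ (Γ : FinDigraph) (S : Type) [Semigroup S] [Finite S] (A : Type) [Finite A] [Nonempty A]
    (φ : OntoHom A S) (ψ : Γ.Vert ⊕ Γ.Edge → S),
    (∃ γ, IsGraphSolution V Γ φ ψ γ) →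
      ∃ γ, (∀ x, SigmaWord σ A (γ x)) ∧ IsGraphSolution V Γ φ ψ γ

end Pseudo

/-! Write V = DO ∩ H̄. For each s in P choose a pseudoword `w s` in the witness P' with value s
under φ. This finite family is uniform over V (all members have one projection), and its projection
is idempotent. Its members have to be replaced by (σ ∪ {ω})-words with the same values under φ,
keeping uniformity and idempotency over V.

Two properties of V carry the proof. First, V determines the content of a pseudoword and its
factorization at the first or last occurrence of a letter (`first_occurrence_unique`,
`last_occurrence_unique`), so a uniform family splits into uniform families. Second, if m and n have
the same content B and s has content in B, then m^ω s n^ω depends over V only on m and n over V and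
on s over H (`omega_mul_mul_omega_eq`).

By induction on the content B, families of smaller content are approximable. From a family w that is
not approximable one can peel blocks u a off the left for ever, each u of smaller content: if the
process stopped, w would be a product of approximable blocks. The pigeonhole principle on values in
S^I gives blocks p, m with w = p r and φ(p)φ(m) = φ(p). Peeling from the right likewise gives w = p
s q with φ(n)φ(q) = φ(q). The approximant is p' m'^ω s' n'^ω q', where s' consists of σ-words
uniform over H. A family that is idempotent over V admits the same decomposition, because the
remainders stay in the ideal generated by one of its members.

For idempotency, `Approximable` records the list of families that still await replacement over H.
This list is viewed as a closed path, with parallel edges indexed by I at each step. Graph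
σ-reducibility solves the resulting system at once: parallel edges give uniformity over H, and
closedness makes the approximant idempotent over H. Then s' n'^ω q' p' m'^ω s' = s' over H, and the
second property lifts idempotency to V. -/

namespace Pseudo

/-! ### Evaluation of pseudowords in finite semigroups. -/

section Evaluation

variable {A S T : Type} [Semigroup S] [Finite S] [Semigroup T] [Finite T]

theorem lift_comp {S T : Type} [Semigroup S] [Semigroup T] (k : S →ₙ* T) (f : A → S)
    (r : FreeSemigroup A) :
    FreeSemigroup.lift (fun a => k (f a)) r = k (FreeSemigroup.lift f r) := by
  induction r with
  | ih1 i => simp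
  | ih2 i r _ ih => rw [map_mul, map_mul, map_mul, ih]; simp

theorem lift_coe (c : Con (FreeSemigroup A)) (r : FreeSemigroup A) :
    FreeSemigroup.lift (fun a => ((FreeSemigroup.of a : FreeSemigroup A) : c.Quotient)) r = r := by
  induction r with
  | ih1 i => simp
  | ih2 i r _ ih => rw [map_mul, ih, Con.coe_mul]; simp

theorem evalAt_eq_lift (x : Pseudoword A) (f : A → S)
    (c : {c : Con (FreeSemigroup A) // allFinite.Mem c.Quotient})
    (hc : c.1 ≤ Con.ker (FreeSemigroup.lift f)) (r : FreeSemigroup A)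
    (hr : (r : c.1.Quotient) = x.1 c) : evalAt x f = FreeSemigroup.lift f r :=
  evalAt_eq x f r (x.2 c ⟨_, finite_ker f⟩ hc r hr)

/-- Evaluation in S × T yields one word that represents the pseudoword for both valuations. Facts
about words are transferred to pseudowords in this way. -/
theorem exists_word_pair (x : Pseudoword A) (f : A → S) (g : A → T) :
    ∃ r, FreeSemigroup.lift f r = evalAt x f ∧ FreeSemigroup.lift g r = evalAt x g := by
  let h : A → S × T := fun a => (f a, g a)
  have h1 : ∀ r, FreeSemigroup.lift f r = (FreeSemigroup.lift h r).1 :=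
    fun r => lift_comp (MulHom.fst S T) h r
  have h2 : ∀ r, FreeSemigroup.lift g r = (FreeSemigroup.lift h r).2 :=
    fun r => lift_comp (MulHom.snd S T) h r
  obtain ⟨r, hr⟩ := Quotient.exists_rep (x.1 ⟨_, finite_ker h⟩)
  refine ⟨r, (evalAt_eq_lift x f ⟨_, finite_ker h⟩ ?_ r hr).symm,
    (evalAt_eq_lift x g ⟨_, finite_ker h⟩ ?_ r hr).symm⟩
  · intro a b hab
    have hab' : FreeSemigroup.lift h a = FreeSemigroup.lift h b := hab
    change FreeSemigroup.lift f a = FreeSemigroup.lift f b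
    rw [h1, h1, hab']
  · intro a b hab
    have hab' : FreeSemigroup.lift h a = FreeSemigroup.lift h b := hab
    change FreeSemigroup.lift g a = FreeSemigroup.lift g b
    rw [h2, h2, hab']

theorem evalAt_comp (k : S →ₙ* T) (x : Pseudoword A) (f : A → S) :
    evalAt x (fun a => k (f a)) = k (evalAt x f) := by
  obtain ⟨r, h1, h2⟩ := exists_word_pair x f (fun a => k (f a))
  rw [← h1, ← h2, lift_comp]

theorem evalAt_mul (x y : Pseudoword A) (f : A → S) :
    evalAt (x * y) f = evalAt x f * evalAt y f := by
  obtain ⟨r, hr⟩ := Quotient.exists_rep (x.1 ⟨_, finite_ker f⟩)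
  obtain ⟨s, hs⟩ := Quotient.exists_rep (y.1 ⟨_, finite_ker f⟩)
  rw [evalAt_eq x f r hr, evalAt_eq y f s hs, ← map_mul]
  refine evalAt_eq _ f _ ?_
  rw [Con.coe_mul]
  exact congrArg₂ (· * ·) hr hs

/-- Evaluation of pseudowords in a finite semigroup. -/
noncomputable def evalHom (f : A → S) : Pseudoword A →ₙ* S where
  toFun x := evalAt x f
  map_mul' x y := evalAt_mul x y f

@[simp] theorem evalAt_letter (a : A) (f : A → S) : evalAt (letter a) f = f a := by
  rw [evalAt_eq (letter a) f (FreeSemigroup.of a) rfl, FreeSemigroup.lift_of]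

instance finite_quotient (c : {c : Con (FreeSemigroup A) // allFinite.Mem c.Quotient}) :
    Finite c.1.Quotient := c.2

theorem coord_eq_evalAt (x : Pseudoword A)
    (c : {c : Con (FreeSemigroup A) // allFinite.Mem c.Quotient}) :
    x.1 c = evalAt x (fun a => ((FreeSemigroup.of a : FreeSemigroup A) : c.1.Quotient)) := by
  obtain ⟨r, hr⟩ := Quotient.exists_rep (x.1 c)
  refine hr.symm.trans ((lift_coe c.1 r).symm.trans (evalAt_eq_lift x _ c ?_ r hr).symm)
  · intro a b hab
    change FreeSemigroup.lift _ a = FreeSemigroup.lift _ b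
    rw [lift_coe, lift_coe]
    exact (Con.eq _).2 hab

theorem pseudoword_ext {x y : Pseudoword A}
    (h : ∀ (S : Type) [Semigroup S] [Finite S] (f : A → S), evalAt x f = evalAt y f) : x = y := by
  refine Subtype.ext (funext fun c => ?_)
  exact (coord_eq_evalAt x c).trans ((h _ _).trans (coord_eq_evalAt y c).symm)

/-- The embedding of the quotient of the free semigroup by the kernel of `lift f`. -/
def kerEmb {S : Type} [Semigroup S] (f : A → S) :
    (Con.ker (FreeSemigroup.lift f)).Quotient →ₙ* S where
  toFun q := Con.liftOn q (FreeSemigroup.lift f) fun _ _ h => h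
  map_mul' p q := by
    induction p using Con.induction_on
    induction q using Con.induction_on
    rw [← Con.coe_mul]
    exact map_mul _ _ _

theorem kerEmb_injective {S : Type} [Semigroup S] (f : A → S) :
    Function.Injective (kerEmb f) := by
  intro p q
  induction p using Con.induction_on
  induction q using Con.induction_on
  intro h
  exact (Con.eq _).2 h

theorem kerEmb_coord (x : Pseudoword A) (f : A → S) :
    evalAt x f = kerEmb f (x.1 ⟨_, finite_ker f⟩) := rfl

/-- The quotient by the kernel of `lift f` embeds in S, so closure under subsemigroups makes it one
of the coordinates of `freePro V A`. -/
theorem proj_eq_iff {V : FinSemigroupClass} [Nonempty A]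
    (hsub : ∀ (S T : Type) [Semigroup S] [Semigroup T] [Nonempty S] (f : S →ₙ* T),
      Function.Injective f → V.Mem T → V.Mem S) {x y : Pseudoword A} :
    proj V A x = proj V A y ↔ ∀ (S : Type) [Semigroup S] [Finite S], V.Mem S → ∀ f : A → S,
      evalAt x f = evalAt y f := by
  constructor
  · intro h S _ _ hS f
    have : Nonempty (Con.ker (FreeSemigroup.lift f)).Quotient :=
      ⟨((FreeSemigroup.of (Classical.arbitrary A) : FreeSemigroup A) : Con.Quotient _)⟩
    have hm := hsub _ _ (kerEmb f) (kerEmb_injective f) hS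
    have := congrFun (congrArg Subtype.val h) ⟨_, hm⟩
    rw [kerEmb_coord, kerEmb_coord]
    exact congrArg (kerEmb f) this
  · intro h
    refine Subtype.ext (funext fun c => ?_)
    have : Finite c.1.Quotient := V.finite_of_mem _ c.2
    exact (coord_eq_evalAt x ⟨c.1, this⟩).trans
      ((h _ c.2 _).trans (coord_eq_evalAt y ⟨c.1, this⟩).symm)

theorem evalAt_subst {X : Type} (u : Pseudoword X) (w : X → Pseudoword A) (f : A → S) :
    evalAt (subst u w) f = evalAt u fun i => evalAt (w i) f := by
  have := finite_ker f
  rw [kerEmb_coord]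
  exact (evalAt_comp (kerEmb f) u fun i => (w i).1 ⟨_, finite_ker f⟩).symm

end Evaluation

/-! ### The ω-power and closure properties of σ-words. -/

section Omega

variable {A S : Type} [Semigroup S] [Finite S]

theorem omegaPow_mem (s : S) : omegaPow s ∈ Subsemigroup.closure {s} :=
  (exists_idempotent_power s).choose_spec.1

theorem isIdempotentElem_omegaPow (s : S) : IsIdempotentElem (omegaPow s) :=
  (exists_idempotent_power s).choose_spec.2

theorem map_mem_closure_singleton {S T : Type} [Semigroup S] [Semigroup T] (k : S →ₙ* T) {s e : S}
    (h : e ∈ Subsemigroup.closure {s}) : k e ∈ Subsemigroup.closure {k s} := by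
  have := Subsemigroup.mem_map_of_mem k h
  rwa [MulHom.map_mclosure, Set.image_singleton] at this

theorem map_omegaPow {T : Type} [Semigroup T] [Finite T] (k : S →ₙ* T) (s : S) :
    k (omegaPow s) = omegaPow (k s) := by
  refine idempotent_power_unique (map_mem_closure_singleton k (omegaPow_mem s)) (omegaPow_mem _)
    ?_ (isIdempotentElem_omegaPow _)
  unfold IsIdempotentElem
  rw [← map_mul, (isIdempotentElem_omegaPow s).eq]

theorem evalAt_omegaWord (f : Fin 1 → S) : evalAt omegaWord f = omegaPow (f 0) := by
  have := finite_ker f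
  rw [kerEmb_coord]
  change kerEmb f (omegaPow ((letter (0 : Fin 1)).1 ⟨_, finite_ker f⟩)) = _
  rw [map_omegaPow, ← kerEmb_coord, evalAt_letter]

/-- The pseudoword `x^ω`. -/
noncomputable def omega (x : Pseudoword A) : Pseudoword A := subst omegaWord fun _ => x

theorem evalAt_omega (x : Pseudoword A) (f : A → S) :
    evalAt (omega x) f = omegaPow (evalAt x f) := by
  rw [omega, evalAt_subst, evalAt_omegaWord]

theorem mul_of_mem_closure {S : Type} [Semigroup S] {p s e : S} (h : p * s = p)
    (he : e ∈ Subsemigroup.closure {s}) : p * e = p := by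
  induction he using Subsemigroup.closure_induction with
  | mem x hx => rw [Set.mem_singleton_iff.1 hx, h]
  | mul x y _ _ hx hy => rw [← mul_assoc, hx, hy]

theorem mul_of_mem_closure_left {S : Type} [Semigroup S] {p s e : S} (h : s * p = p)
    (he : e ∈ Subsemigroup.closure {s}) : e * p = p := by
  induction he using Subsemigroup.closure_induction with
  | mem x hx => rw [Set.mem_singleton_iff.1 hx, h]
  | mul x y _ _ hx hy => rw [mul_assoc, hy, hx]

theorem subst_mul (w : Fin 2 → Pseudoword A) :
    subst (letter 0 * letter 1) w = w 0 * w 1 := by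
  refine pseudoword_ext fun S _ _ f => ?_
  rw [evalAt_subst, evalAt_mul, evalAt_mul, evalAt_letter, evalAt_letter]

theorem SigmaWord.mul {σ : ImplicitSignature} {x y : Pseudoword A} (hx : SigmaWord σ A x)
    (hy : SigmaWord σ A y) : SigmaWord σ A (x * y) := by
  have := SigmaWord.op 2 _ σ.mul_mem ![x, y] (by intro i; fin_cases i <;> assumption)
  rwa [subst_mul] at this

theorem SigmaWord.omega {σ : ImplicitSignature} {x : Pseudoword A}
    (hx : SigmaWord σ.addOmega A x) : SigmaWord σ.addOmega A (omega x) :=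
  SigmaWord.op (σ := σ.addOmega) 1 omegaWord (Or.inr rfl) (fun _ => x) fun _ => hx

theorem SigmaWord.addOmega {σ : ImplicitSignature} {x : Pseudoword A}
    (hx : SigmaWord σ A x) : SigmaWord σ.addOmega A x := by
  induction hx with
  | letter a => exact SigmaWord.letter a
  | op n u hu w _ ih => exact SigmaWord.op (σ := σ.addOmega) n u (Or.inl hu) w ih

end Omega

/-! ### Continuity, and the value of an abstract continuous homomorphism at an ω-power. -/

section Continuity

variable {A S : Type} [Semigroup S]

theorem isOpen_coord_eq (V : FinSemigroupClass) (x : freePro V A)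
    (c : {c : Con (FreeSemigroup A) // V.Mem c.Quotient}) :
    IsOpen {y : freePro V A | y.1 c = x.1 c} := by
  refine ⟨{g | g c = x.1 c}, ?_, rfl⟩
  let _ : ∀ c : {c : Con (FreeSemigroup A) // V.Mem c.Quotient},
    TopologicalSpace c.1.Quotient := fun _ => ⊥
  have h : Continuous fun g : (∀ c : {c : Con (FreeSemigroup A) // V.Mem c.Quotient},
    c.1.Quotient) => g c := continuous_apply c
  exact h.isOpen_preimage {x.1 c} trivial

theorem isOpen_evalAt_eq [Finite S] (f : A → S) (x : Pseudoword A) :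
    IsOpen {y : Pseudoword A | evalAt y f = evalAt x f} := by
  convert isOpen_coord_eq allFinite x ⟨_, finite_ker f⟩ using 1
  ext y
  exact (kerEmb_injective f).eq_iff

/-- A neighbourhood of a pseudoword contains all pseudowords congruent to it modulo a suitable
congruence of finite index. -/
theorem exists_coord_of_isOpen {U : Set (Pseudoword A)} (hU : IsOpen U) {x : Pseudoword A}
    (hx : x ∈ U) : ∃ (T : Type) (_ : Semigroup T) (_ : Finite T) (f : A → T),
      ∀ y, evalAt y f = evalAt x f → y ∈ U := by
  obtain ⟨O, hO, rfl⟩ := hU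
  let _ : ∀ c : {c : Con (FreeSemigroup A) // allFinite.Mem c.Quotient},
    TopologicalSpace c.1.Quotient := fun _ => ⊥
  obtain ⟨F, u, hu, hF⟩ := isOpen_pi_iff.1 hO x.1 hx
  refine ⟨∀ c : F, c.1.1.Quotient, inferInstance, ?_,
    fun a c => ((FreeSemigroup.of a : FreeSemigroup A) : c.1.1.Quotient), ?_⟩
  · have : ∀ c : F, Finite c.1.1.Quotient := fun c => c.1.2
    infer_instance
  · have : ∀ c : F, Finite c.1.1.Quotient := fun c => c.1.2
    intro y hy
    refine hF fun c hc => ?_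
    have h1 := congrFun hy ⟨c, hc⟩
    have h2 : ∀ z : Pseudoword A, z.1 c = evalAt z
        (fun a (c : F) => ((FreeSemigroup.of a : FreeSemigroup A) : c.1.1.Quotient)) ⟨c, hc⟩ := by
      intro z
      exact (coord_eq_evalAt z c).trans (evalAt_comp
        (Pi.evalMulHom (fun c : F => c.1.1.Quotient) ⟨c, hc⟩) z
        (fun a (c : F) => ((FreeSemigroup.of a : FreeSemigroup A) : c.1.1.Quotient)))
    rw [h2 y, h1, ← h2 x]
    exact (hu c hc).2

/-- By continuity φ takes the same value at x^ω as at some ordinary power of x close to it.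
Membership in the cyclic subsemigroup is all that the absorption arguments need. -/
theorem OntoHom.map_omega [Finite S] (φ : OntoHom A S) (x : Pseudoword A) :
    φ.hom (omega x) ∈ Subsemigroup.closure {φ.hom x} := by
  have hU : IsOpen (φ.hom ⁻¹' {φ.hom (omega x)}) := by
    let _ : TopologicalSpace S := ⊥
    have : DiscreteTopology S := ⟨rfl⟩
    exact (isOpen_discrete _).preimage φ.continuous
  obtain ⟨T, _, _, f, hf⟩ := exists_coord_of_isOpen hU (x := omega x) rfl
  have key : ∀ t ∈ Subsemigroup.closure {evalAt x f}, ∃ y ∈ Subsemigroup.closure {x},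
      evalAt y f = t := by
    intro t ht
    have : t ∈ (Subsemigroup.closure {x}).map (evalHom f) := by
      rwa [MulHom.map_mclosure, Set.image_singleton]
    exact this
  obtain ⟨y, hy, hyt⟩ := key _ (omegaPow_mem (evalAt x f))
  have h1 : φ.hom y = φ.hom (omega x) := hf y (by rw [hyt, evalAt_omega])
  rw [← h1]
  exact map_mem_closure_singleton φ.hom hy

end Continuity

/-! ### Green's relation J and the characterization of DO by e g e = e. -/

section Green

theorem JEquiv.refl {S : Type} [Semigroup S] (a : S) : JEquiv a a :=
  ⟨⟨1, 1, by simp⟩, ⟨1, 1, by simp⟩⟩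

theorem JEquiv.symm {S : Type} [Semigroup S] {a b : S} (h : JEquiv a b) : JEquiv b a := ⟨h.2, h.1⟩

theorem JLE.trans {S : Type} [Semigroup S] {a b c : S} (h : JLE a b) (h' : JLE b c) :
    JLE a c := by
  obtain ⟨x, y, h⟩ := h
  obtain ⟨z, t, h'⟩ := h'
  exact ⟨x * z, t * y, by rw [h, h']; simp only [mul_assoc]⟩

theorem JEquiv.trans {S : Type} [Semigroup S] {a b c : S} (h : JEquiv a b) (h' : JEquiv b c) :
    JEquiv a c := ⟨h.1.trans h'.1, h'.2.trans h.2⟩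

theorem JLE.map {S T : Type} [Semigroup S] [Semigroup T] (k : S →ₙ* T) {a b : S} (h : JLE a b) :
    JLE (k a) (k b) := by
  obtain ⟨x, y, h⟩ := h
  refine ⟨WithOne.mapMulHom k x, WithOne.mapMulHom k y, ?_⟩
  have := congrArg (WithOne.mapMulHom k) h
  simpa using this

theorem JEquiv.map {S T : Type} [Semigroup S] [Semigroup T] (k : S →ₙ* T) {a b : S}
    (h : JEquiv a b) : JEquiv (k a) (k b) := ⟨h.1.map k, h.2.map k⟩

theorem jLE_iff_of_monoid {M : Type} [Monoid M] {a b : M} : JLE a b ↔ ∃ x y, a = x * b * y := by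
  constructor
  · rintro ⟨x, y, h⟩
    refine ⟨WithOne.lift (MulHom.id M) x, WithOne.lift (MulHom.id M) y, ?_⟩
    have := congrArg (WithOne.lift (MulHom.id M)) h
    simpa using this
  · rintro ⟨x, y, h⟩
    exact ⟨x, y, by rw [h]; simp⟩

/-- Stability of finite monoids. Iteration gives e = z e j for every power j of w; the idempotent
power then fixes e on the right, and it begins with w. -/
theorem exists_right_of_eq_mul_mul {M : Type} [Monoid M] [Finite M] {e x w : M}
    (h : e = x * e * w) : ∃ t, e = e * w * t := by
  have h1 : ∀ j ∈ Subsemigroup.closure {w}, (∃ z, e = z * e * j) ∧ ∃ t, j = w * t := by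
    intro j hj
    induction hj using Subsemigroup.closure_induction with
    | mem j hj =>
      rw [Set.mem_singleton_iff] at hj
      exact ⟨⟨x, by rw [hj]; exact h⟩, 1, by rw [hj, mul_one]⟩
    | mul j k _ _ hj hk =>
      obtain ⟨⟨z, hz⟩, t, ht⟩ := hj
      obtain ⟨⟨z', hz'⟩, -⟩ := hk
      refine ⟨⟨z' * z, ?_⟩, t * k, by rw [ht, mul_assoc]⟩
      calc e = z' * e * k := hz'
        _ = z' * (z * e * j) * k := by rw [← hz]
        _ = _ := by simp only [mul_assoc]
  obtain ⟨⟨z, hz⟩, t, ht⟩ := h1 _ (omegaPow_mem w)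
  have hid := (isIdempotentElem_omegaPow w).eq
  refine ⟨t, ?_⟩
  rw [mul_assoc, ← ht]
  calc e = z * e * omegaPow w := hz
    _ = z * e * (omegaPow w * omegaPow w) := by rw [hid]
    _ = (z * e * omegaPow w) * omegaPow w := by simp only [mul_assoc]
    _ = _ := by rw [← hz]

theorem exists_left_of_eq_mul_mul {M : Type} [Monoid M] [Finite M] {e x w : M}
    (h : e = x * e * w) : ∃ t, e = t * x * e := by
  have : MulOpposite.op e = MulOpposite.op w * MulOpposite.op e * MulOpposite.op x := by
    rw [← MulOpposite.op_mul, ← MulOpposite.op_mul, ← mul_assoc, ← h]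
  have : Finite Mᵐᵒᵖ := Finite.of_equiv M MulOpposite.opEquiv
  obtain ⟨t, ht⟩ := exists_right_of_eq_mul_mul ‹MulOpposite.op e = _›
  exact ⟨t.unop, by simpa [mul_assoc] using congrArg MulOpposite.unop ht⟩

/-- `e g e = e` for all `J`-equivalent idempotents `e` and `g`. For finite semigroups this
characterizes membership in `DO`. -/
def RectangularIdempotents (S : Type) [Semigroup S] : Prop :=
  ∀ e g : S, IsIdempotentElem e → IsIdempotentElem g → JEquiv e g → e * g * e = e

/-- The element e g e is an idempotent below e and in the J-class of e, so stability forces it to be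
e. -/
theorem rectangularIdempotents_of_classDO {S : Type} [Semigroup S] (h : classDO.Mem S) :
    RectangularIdempotents S := by
  have : Finite S := h.1
  have : Finite (WithOne S) := inferInstanceAs (Finite (Option S))
  intro e g he hg heg
  obtain ⟨h1, h2⟩ := h.2 e ⟨e, by rw [he.eq, he.eq]⟩
  have hj := h1 _ _ (h1 _ _ (.refl e) heg.symm) (.refl e)
  have hid := h2 _ _ (h1 _ _ (.refl e) heg.symm) (.refl e) (h2 e g (.refl e) heg.symm he hg) he
  obtain ⟨x, y, hxy⟩ := hj.2
  have hh : (e : WithOne S) * (e * g * e : S) = (e * g * e : S) := by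
    rw [← WithOne.coe_mul, ← mul_assoc, ← mul_assoc, he.eq]
  have hz : (e : WithOne S) = x * e * ((e * g * e : S) * y) := by
    rw [← mul_assoc, mul_assoc x, hh, ← hxy]
  obtain ⟨t, ht⟩ := exists_right_of_eq_mul_mul hz
  rw [← mul_assoc, hh] at ht
  apply WithOne.coe_injective
  calc ((e * g * e : S) : WithOne S) = (e * g * e : S) * e := by
        rw [← WithOne.coe_mul, mul_assoc _ e e, he.eq]
    _ = (e * g * e : S) * ((e * g * e : S) * y * t) := by rw [← ht]
    _ = ((e * g * e) * (e * g * e) : S) * y * t := by simp only [mul_assoc, WithOne.coe_mul]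
    _ = e := by rw [hid.eq, ← ht]

theorem exists_coe_eq_mul_mul {S : Type} [Semigroup S] (x y : WithOne S) (s : S) :
    ∃ t : S, (t : WithOne S) = x * s * y := by
  induction x with
  | one =>
    induction y with
    | one => exact ⟨s, by simp⟩
    | coe y => exact ⟨s * y, by simp⟩
  | coe x =>
    induction y with
    | one => exact ⟨x * s, by simp⟩
    | coe y => exact ⟨x * s * y, by simp⟩

/-- For x and y in the J-class of an idempotent e, take an idempotent p in the L-class of x and an
idempotent k in the R-class of y. Since p k p = p, the product x y does not drop below the J-class.
-/
theorem classDO_of_rectangularIdempotents {S : Type} [Semigroup S] [hS : Finite S]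
    (h : RectangularIdempotents S) : classDO.Mem S := by
  have : Finite (WithOne S) := inferInstanceAs (Finite (Option S))
  refine ⟨hS, fun a ⟨z, hz⟩ => ⟨?_, ?_⟩⟩
  · intro x y hx hy
    obtain ⟨e, he, hea⟩ : ∃ e : S, IsIdempotentElem e ∧ JEquiv e a := by
      refine ⟨a * z, ?_, ⟨1, z, by simp⟩, ⟨1, a, ?_⟩⟩
      · unfold IsIdempotentElem
        rw [← mul_assoc, hz]
      · rw [one_mul, ← WithOne.coe_mul, hz]
    refine JEquiv.trans ?_ hea
    have ee : (e : WithOne S) * e = e := by rw [← WithOne.coe_mul, he.eq]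
    obtain ⟨⟨s', t', hx'⟩, ⟨s, t, hs⟩⟩ := hx.trans hea.symm
    obtain ⟨⟨u', v', hy'⟩, ⟨u, v, hu⟩⟩ := hy.trans hea.symm
    have h1 : (e : WithOne S) = (s * s') * e * (t' * t) := by
      rw [hx'] at hs; exact hs.trans (by simp only [mul_assoc])
    have h2 : (e : WithOne S) = (u * u') * e * (v' * v) := by
      rw [hy'] at hu; exact hu.trans (by simp only [mul_assoc])
    obtain ⟨r1, hr1⟩ : ∃ r, (e : WithOne S) * t' * r = e := by
      obtain ⟨r, hr⟩ := exists_right_of_eq_mul_mul h1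
      exact ⟨t * r, by rw [← mul_assoc, mul_assoc (e : WithOne S) t' t, ← hr]⟩
    obtain ⟨r2, hr2⟩ : ∃ r, (e : WithOne S) * v' * r = e := by
      obtain ⟨r, hr⟩ := exists_right_of_eq_mul_mul h2
      exact ⟨v * r, by rw [← mul_assoc, mul_assoc (e : WithOne S) v' v, ← hr]⟩
    obtain ⟨l1, hl1⟩ : ∃ r, r * (s' * (e : WithOne S)) = e := by
      obtain ⟨r, hr⟩ := exists_left_of_eq_mul_mul h1
      exact ⟨r * s, by rw [← mul_assoc, mul_assoc r s s', ← hr]⟩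
    obtain ⟨l2, hl2⟩ : ∃ r, r * (u' * (e : WithOne S)) = e := by
      obtain ⟨r, hr⟩ := exists_left_of_eq_mul_mul h2
      exact ⟨r * u, by rw [← mul_assoc, mul_assoc r u u', ← hr]⟩
    obtain ⟨p, hp⟩ := exists_coe_eq_mul_mul r1 t' e
    obtain ⟨k, hk⟩ := exists_coe_eq_mul_mul u' l2 e
    have hr1' : ∀ w, (e : WithOne S) * (t' * (r1 * w)) = e * w := fun w => by
      rw [← mul_assoc, ← mul_assoc, hr1]
    have hr2' : ∀ w, (e : WithOne S) * (v' * (r2 * w)) = e * w := fun w => by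
      rw [← mul_assoc, ← mul_assoc, hr2]
    have hl1' : ∀ w, l1 * (s' * ((e : WithOne S) * w)) = e * w := fun w => by
      rw [← mul_assoc s', ← mul_assoc, hl1]
    have hl2' : ∀ w, l2 * (u' * ((e : WithOne S) * w)) = e * w := fun w => by
      rw [← mul_assoc u', ← mul_assoc, hl2]
    have hr1'' : (e : WithOne S) * (t' * r1) = e := by rw [← mul_assoc, hr1]
    have hr2'' : (e : WithOne S) * (v' * r2) = e := by rw [← mul_assoc, hr2]
    have ee' : ∀ w, (e : WithOne S) * (e * w) = e * w := fun w => by rw [← mul_assoc, ee]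
    have hpi : IsIdempotentElem p := by
      apply WithOne.coe_injective
      rw [WithOne.coe_mul, hp]
      simp only [mul_assoc, hr1', ee']
    have hki : IsIdempotentElem k := by
      apply WithOne.coe_injective
      rw [WithOne.coe_mul, hk]
      simp only [mul_assoc, hl2', ee']
    have hpe : JEquiv p e := ⟨⟨r1, t', hp⟩, ⟨e * t', r1, by
      rw [hp]; simp only [mul_assoc, hr1', hr1'', ee']⟩⟩
    have hke : JEquiv k e := ⟨⟨u', l2, hk⟩, ⟨l2, u' * e, by
      rw [hk]; simp only [mul_assoc, hl2', hl2, ee]⟩⟩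
    have hpk := h p k hpi hki (hpe.trans hke.symm)
    have hpk' : (p : WithOne S) * (k * p) = p := by
      rw [← WithOne.coe_mul, ← WithOne.coe_mul, ← mul_assoc, hpk]
    refine ⟨⟨s', t' * y, by rw [WithOne.coe_mul, hx']; simp only [mul_assoc]⟩,
      ⟨l1, r2 * l2 * p * r1, ?_⟩⟩
    calc (e : WithOne S) = e * t' * p * r1 := by
          rw [hp]; simp only [mul_assoc, hr1', hr1'', ee']
      _ = e * t' * (p * (k * p)) * r1 := by rw [hpk']
      _ = e * t' * (r1 * e * t' * (u' * e * l2 * p)) * r1 := by rw [← hp, ← hk]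
      _ = e * (t' * (u' * (e * (l2 * (p * r1))))) := by simp only [mul_assoc, hr1', ee']
      _ = _ := by
          rw [WithOne.coe_mul, hx', hy']
          simp only [mul_assoc, hl1', hr2']
  · intro e f he hf hei hfi
    unfold IsIdempotentElem
    rw [← mul_assoc, h e f hei hfi (he.trans hf.symm)]

end Green

/-! ### Closure properties of DO ∩ H̄. -/

section Membership

/-- The pseudovariety `DO ∩ H̄`. -/
abbrev classDOBar (H : FinSemigroupClass) : FinSemigroupClass := classDO.inter H.bar

variable {H : FinSemigroupClass}

theorem mem_of_injective_of_bar (hH : H.IsGroupPseudovariety) {G T : Type}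
    [Semigroup G] [Semigroup T] (hT : H.bar.Mem T) (hG : IsGroupSemigroup G) (k : G →ₙ* T)
    (hk : Function.Injective k) : H.Mem G := by
  obtain ⟨K, _, ⟨i⟩⟩ := hG
  have e : G ≃* k.srange := MulEquiv.ofBijective k.srangeRestrict
    ⟨fun a b hab => hk (congrArg Subtype.val hab), k.srangeRestrict_surjective⟩
  have : Nonempty G := ⟨i.symm 1⟩
  exact hH.isPseudovariety.sub G k.srange e.toMulHom e.injective
    (hT.2 _ ⟨K, inferInstance, ⟨e.symm.trans i⟩⟩)

theorem bar_mem_of_injective_on_subgroups (hH : H.IsGroupPseudovariety) {S T : Type}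
    [Semigroup S] [Semigroup T] [hS : Finite S] (hT : H.bar.Mem T)
    (h : ∀ G : Subsemigroup S, IsGroupSemigroup G →
      ∃ k : G →ₙ* T, Function.Injective k) : H.bar.Mem S := by
  refine ⟨hS, fun G hG => ?_⟩
  obtain ⟨k, hk⟩ := h G hG
  exact mem_of_injective_of_bar hH hT hG k hk

theorem classDOBar_mem_iff {S : Type} [Semigroup S] :
    (classDOBar H).Mem S ↔ Finite S ∧ RectangularIdempotents S ∧ H.bar.Mem S :=
  ⟨fun h => ⟨h.1.1, rectangularIdempotents_of_classDO h.1, h.2⟩,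
    fun ⟨_, h, h'⟩ => ⟨classDO_of_rectangularIdempotents h, h'⟩⟩

theorem classDOBar_sub (hH : H.IsGroupPseudovariety) (S T : Type) [Semigroup S] [Semigroup T]
    [Nonempty S] (f : S →ₙ* T) (hf : Function.Injective f) (hT : (classDOBar H).Mem T) :
    (classDOBar H).Mem S := by
  rw [classDOBar_mem_iff] at hT ⊢
  obtain ⟨_, hT, hT'⟩ := hT
  have : Finite S := Finite.of_injective f hf
  refine ⟨this, fun e g he hg h => hf ?_, bar_mem_of_injective_on_subgroups hH hT' fun G _ =>
    ⟨f.comp (MulMemClass.subtype G), hf.comp Subtype.val_injective⟩⟩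
  rw [map_mul, map_mul]
  exact hT _ _ (he.map f) (hg.map f) (h.map f)

theorem IsGroupSemigroup.exists_identity {S : Type} [Semigroup S] (h : IsGroupSemigroup S) :
    ∃ e : S, (∀ x, e * x = x) ∧ (∀ x, x * e = x) ∧ ∀ x, ∃ y, x * y = e := by
  obtain ⟨K, _, ⟨i⟩⟩ := h
  refine ⟨i.symm 1, fun x => i.injective (by simp), fun x => i.injective (by simp),
    fun x => ⟨i.symm (i x)⁻¹, i.injective (by simp)⟩⟩

theorem IsGroupSemigroup.mul_left_cancel {S : Type} [Semigroup S] (h : IsGroupSemigroup S)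
    {a b c : S} (hab : a * b = a * c) : b = c := by
  obtain ⟨K, _, ⟨i⟩⟩ := h
  have := congrArg i hab
  rw [map_mul, map_mul] at this
  exact i.injective (_root_.mul_left_cancel this)

theorem IsGroupSemigroup.idempotent_mul {S : Type} [Semigroup S] (h : IsGroupSemigroup S)
    {e : S} (he : IsIdempotentElem e) (x : S) : e * x = x :=
  h.mul_left_cancel (a := e) (by rw [← mul_assoc, he.eq])

theorem IsGroupSemigroup.of_identity {S : Type} [Semigroup S] (e : S)
    (h2 : ∀ x, x * e = x) (h3 : ∀ x, ∃ y, x * y = e) : IsGroupSemigroup S := by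
  choose inv hinv using h3
  let _ : Inv S := ⟨inv⟩
  let _ : One S := ⟨e⟩
  exact ⟨S, Group.ofRightAxioms mul_assoc h2 hinv, ⟨MulEquiv.refl S⟩⟩

theorem classDOBar_of_group (hH : H.IsGroupPseudovariety) {S : Type} [Semigroup S]
    (hS : H.Mem S) : (classDOBar H).Mem S := by
  have hf := H.finite_of_mem S hS
  have hg := hH.isGroup S hS
  refine classDOBar_mem_iff.2 ⟨hf, fun e g he hg' _ => ?_, hf, fun G hG => ?_⟩
  · rw [hg.idempotent_mul he, hg.idempotent_mul hg']
  · have : Nonempty G := ⟨hG.exists_identity.choose⟩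
    exact hH.isPseudovariety.sub G S (MulMemClass.subtype G) Subtype.val_injective hS

theorem bar_mem_unit (hH : H.IsGroupPseudovariety) : H.bar.Mem Unit :=
  (classDOBar_of_group hH hH.isPseudovariety.unit).2

/-- Under multiplication `ZMod 2` is the two-element semilattice. Its membership makes the content
an invariant over DO ∩ H̄. -/
theorem classDOBar_zmod_two (hH : H.IsGroupPseudovariety) : (classDOBar H).Mem (ZMod 2) := by
  refine classDOBar_mem_iff.2 ⟨inferInstance, fun e g _ _ h => ?_,
    bar_mem_of_injective_on_subgroups hH (bar_mem_unit hH) fun G hG =>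
      ⟨⟨fun _ => (), fun _ _ => rfl⟩, ?_⟩⟩
  · obtain ⟨x, y, h1⟩ := jLE_iff_of_monoid.1 h.1
    obtain ⟨z, t, h2⟩ := jLE_iff_of_monoid.1 h.2
    clear h
    have : ∀ e g x y z t : ZMod 2, e = x * g * y → g = z * e * t → e * g * e = e := by decide
    exact this _ _ _ _ _ _ h1 h2
  · obtain ⟨e, he, -, -⟩ := hG.exists_identity
    have hi : ∀ x : G, IsIdempotentElem x := fun x => Subtype.ext (by
      have : ∀ x : ZMod 2, x * x = x := by decide
      exact this x)
    intro x y _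
    have := hG.idempotent_mul (hi x) y
    have := hG.idempotent_mul (hi y) x
    have hc : x * y = y * x := Subtype.ext (mul_comm _ _)
    grind

/-- The adjoined identity is a J-class of its own and adds only a trivial subgroup. Hence it
suffices to test in monoids, where empty factors make sense. -/
theorem classDOBar_withOne (hH : H.IsGroupPseudovariety) {S : Type} [Semigroup S]
    (hS : (classDOBar H).Mem S) : (classDOBar H).Mem (WithOne S) := by
  rw [classDOBar_mem_iff] at hS ⊢
  obtain ⟨_, h1, h2⟩ := hS
  have : Finite (WithOne S) := inferInstanceAs (Finite (Option S))
  have hone : ∀ x y : WithOne S, x * y = 1 → x = 1 ∧ y = 1 := by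
    intro x y h
    induction x <;> induction y <;> simp_all [← WithOne.coe_mul]
  refine ⟨this, ?_, this, fun G hG => ?_⟩
  · intro e g he hg h
    induction e with
    | one =>
      obtain ⟨x, y, h⟩ := jLE_iff_of_monoid.1 h.1
      rw [(hone x g (hone _ _ h.symm).1).2, one_mul, one_mul]
    | coe e =>
      induction g with
      | one =>
        rw [mul_one, he.eq]
      | coe g =>
        rw [← WithOne.coe_mul, ← WithOne.coe_mul, h1 e g (WithOne.coe_injective he)
          (WithOne.coe_injective hg)
          ⟨jLE_iff_of_monoid.1 h.1, jLE_iff_of_monoid.1 h.2⟩]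
  · obtain ⟨e, he, -, hinv⟩ := hG.exists_identity
    have : Nonempty G := ⟨e⟩
    by_cases h : e.1 = 1
    · have : ∀ x : G, x.1 = 1 := fun x => by
        obtain ⟨y, hy⟩ := hinv x
        exact (hone x.1 y.1 ((congrArg Subtype.val hy).trans h)).1
      refine hH.isPseudovariety.sub G Unit ⟨fun _ => (), fun _ _ => rfl⟩ (fun x y _ => ?_)
        hH.isPseudovariety.unit
      exact Subtype.ext ((this x).trans (this y).symm)
    · have hne : ∀ x : G, x.1 ≠ 1 := fun x hx => h (by
        obtain ⟨y, hy⟩ := hinv x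
        have h3 := congrArg Subtype.val (he x)
        exact (hone e.1 x.1 (h3.trans hx)).1)
      exact mem_of_injective_of_bar hH h2 hG ⟨fun x => WithOne.unone (hne x), fun x y =>
        WithOne.coe_injective (by simp)⟩ fun x y hxy => Subtype.ext (by
          rw [← WithOne.coe_unone (hne x), ← WithOne.coe_unone (hne y)]
          exact congrArg _ hxy)

end Membership

/-! ### A monoid recording the first and last occurrence of a letter. -/

section Split

/-- For a monoid `M` the elements of `Split M` record the value of a word and, if a
distinguished letter occurs in it, the values of the prefix before its first occurrence, the rest
after its first occurrence, the part before its last occurrence, and the suffix after its last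
occurrence. -/
@[ext]
structure Split (M : Type) where
  /-- the value of the word -/
  val : M
  /-- the values of the factors at the first and the last occurrence -/
  occ : Option (M × M × M × M)

variable {M : Type} [Monoid M]

instance [Finite M] : Finite (Split M) :=
  Finite.of_injective (fun x : Split M => (x.val, x.occ)) fun x y h => by
    cases x; cases y; simpa using h

/-- The product of the records of two words. -/
def Split.mulAux : Split M → Split M → Split M
  | ⟨m, none⟩, ⟨m', none⟩ => ⟨m * m', none⟩
  | ⟨m, none⟩, ⟨m', some (p', r', q', s')⟩ => ⟨m * m', some (m * p', r', m * q', s')⟩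
  | ⟨m, some (p, r, q, s)⟩, ⟨m', none⟩ => ⟨m * m', some (p, r * m', q, s * m')⟩
  | ⟨m, some (p, r, _, _)⟩, ⟨m', some (_, _, q', s')⟩ =>
    ⟨m * m', some (p, r * m', m * q', s')⟩

instance : Mul (Split M) := ⟨Split.mulAux⟩

theorem Split.none_mul_none (m m' : M) : (⟨m, none⟩ * ⟨m', none⟩ : Split M) = ⟨m * m', none⟩ := rfl

theorem Split.none_mul_some (m m' p' r' q' s' : M) :
    (⟨m, none⟩ * ⟨m', some (p', r', q', s')⟩ : Split M) =
      ⟨m * m', some (m * p', r', m * q', s')⟩ := rfl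

theorem Split.some_mul_none (m m' p r q s : M) :
    (⟨m, some (p, r, q, s)⟩ * ⟨m', none⟩ : Split M) = ⟨m * m', some (p, r * m', q, s * m')⟩ := rfl

theorem Split.some_mul_some (m m' p r q s p' r' q' s' : M) :
    (⟨m, some (p, r, q, s)⟩ * ⟨m', some (p', r', q', s')⟩ : Split M) =
      ⟨m * m', some (p, r * m', m * q', s')⟩ := rfl

instance : Monoid (Split M) where
  one := ⟨1, none⟩
  mul_assoc := by
    rintro ⟨m, _ | ⟨p, r, q, s⟩⟩ ⟨m', _ | ⟨p', r', q', s'⟩⟩ ⟨m'', _ | ⟨p'', r'', q'', s''⟩⟩ <;>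
      simp only [Split.none_mul_none, Split.none_mul_some, Split.some_mul_none,
        Split.some_mul_some, mul_assoc]
  one_mul := by
    rintro ⟨m, _ | ⟨p, r, q, s⟩⟩
    · exact Split.ext (one_mul _) rfl
    · exact Split.ext (one_mul _) (by
        change some (1 * p, r, 1 * q, s) = _
        rw [one_mul, one_mul])
  mul_one := by
    rintro ⟨m, _ | ⟨p, r, q, s⟩⟩
    · exact Split.ext (mul_one _) rfl
    · exact Split.ext (mul_one _) (by
        change some (p, r * 1, q, s * 1) = _
        rw [mul_one, mul_one])

namespace Split

/-- The value of the word. -/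
def valHom : Split M →* M where
  toFun := val
  map_one' := rfl
  map_mul' := by
    rintro ⟨m, _ | ⟨p, r, q, s⟩⟩ ⟨m', _ | ⟨p', r', q', s'⟩⟩ <;> rfl

theorem occ_eq_none_of_mul {x y : Split M} (h : (x * y).occ = none) :
    x.occ = none ∧ y.occ = none := by
  obtain ⟨m, _ | ⟨p, r, q, s⟩⟩ := x <;> obtain ⟨m', _ | ⟨p', r', q', s'⟩⟩ := y
  · exact ⟨rfl, rfl⟩
  all_goals exact absurd h (by intro h; cases h)

/-- If e has the record (p, r, q, s) and value m, idempotency means r m = r and m q = q. In e f e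
the outer factors supply p and s, and these two relations reduce the other components to the
identity for values. -/
theorem mul_mul_eq_of_val {e f : Split M} (he : IsIdempotentElem e)
    (h : e.val * f.val * e.val = e.val) (hf : e.occ = none → f.occ = none) : e * f * e = e := by
  obtain ⟨m, _ | ⟨p, r, q, s⟩⟩ := e
  · obtain ⟨m', _ | ⟨p', r', q', s'⟩⟩ := f
    · exact Split.ext h rfl
    · cases hf rfl
  · have h1 : r * m = r ∧ m * q = q := by
      have := he.eq
      rw [some_mul_some] at this
      simpa using congrArg occ this
    simp only at h
    obtain ⟨m', _ | ⟨p', r', q', s'⟩⟩ := f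
    · rw [some_mul_none, some_mul_some, h]
      refine congrArg _ ?_
      have a1 : r * m' * m = r := by
        conv_lhs => rw [← h1.1]
        rw [mul_assoc r, mul_assoc r, h, h1.1]
      have a2 : m * m' * q = q := by
        conv_lhs => rw [← h1.2]
        rw [← mul_assoc, h, h1.2]
      rw [a1, a2]
    · rw [some_mul_some, some_mul_some, h]
      refine congrArg _ ?_
      have a1 : r * m' * m = r := by
        conv_lhs => rw [← h1.1]
        rw [mul_assoc r, mul_assoc r, h, h1.1]
      have a2 : m * m' * q = q := by
        conv_lhs => rw [← h1.2]
        rw [← mul_assoc, h, h1.2]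
      rw [a1, a2]

/-- Once e has a record, the record of e x e depends only on e and on the value of x. So a subgroup
with identity e embeds in M through values. -/
theorem eq_of_val_eq {e x y : Split M} (hx : e * x * e = x) (hy : e * y * e = y)
    (hnx : e.occ = none → x.occ = none) (hny : e.occ = none → y.occ = none)
    (h : x.val = y.val) : x = y := by
  obtain ⟨m, _ | ⟨p, r, q, s⟩⟩ := e
  · exact Split.ext h ((hnx rfl).trans (hny rfl).symm)
  · rw [← hx, ← hy]
    obtain ⟨n, _ | ⟨p', r', q', s'⟩⟩ := x <;> obtain ⟨n', _ | ⟨p'', r'', q'', s''⟩⟩ := y <;>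
      simp only at h <;> subst h <;> rfl

theorem classDOBar_mem {H : FinSemigroupClass} (hH : H.IsGroupPseudovariety)
    (hM : (classDOBar H).Mem M) : (classDOBar H).Mem (Split M) := by
  rw [classDOBar_mem_iff] at hM ⊢
  obtain ⟨_, h1, h2⟩ := hM
  refine ⟨inferInstance, fun e g he hg h => ?_, bar_mem_of_injective_on_subgroups hH h2
    fun G hG => ⟨(valHom : Split M →* M).toMulHom.comp (MulMemClass.subtype G), ?_⟩⟩
  · refine mul_mul_eq_of_val he (h1 _ _ (he.map (valHom : Split M →* M))
      (hg.map (valHom : Split M →* M)) (h.map (valHom : Split M →* M).toMulHom)) fun hn => ?_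
    obtain ⟨x, y, hxy⟩ := jLE_iff_of_monoid.1 h.1
    rw [hxy] at hn
    exact (occ_eq_none_of_mul (occ_eq_none_of_mul hn).1).2
  · obtain ⟨e, he, he', hinv⟩ := hG.exists_identity
    have hs : ∀ x : G, e.1 * x.1 * e.1 = x.1 := fun x => by
      have := congrArg Subtype.val ((congrArg (· * e) (he x)).trans (he' x))
      exact this
    have hn : ∀ x : G, e.1.occ = none → x.1.occ = none := fun x h => by
      obtain ⟨y, hy⟩ := hinv x
      rw [← hy] at h
      exact (occ_eq_none_of_mul h).1
    intro x y hxy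
    exact Subtype.ext (eq_of_val_eq (hs x) (hs y) (hn x) (hn y) hxy)

end Split

end Split

/-! ### Content of possibly empty words and pseudowords. -/

section Content

variable {A M N : Type} [Monoid M] [Monoid N]

/-- Evaluation of possibly empty words in a monoid. -/
def wordEval (f : A → M) : WithOne (FreeSemigroup A) →* M := WithOne.lift (FreeSemigroup.lift f)

@[simp] theorem wordEval_coe (f : A → M) (r : FreeSemigroup A) :
    wordEval f r = FreeSemigroup.lift f r := rfl

variable [Finite M] [Finite N]

/-- Evaluation of possibly empty pseudowords in a finite monoid. -/
noncomputable def evalOne (f : A → M) : WithOne (Pseudoword A) →* M := WithOne.lift (evalHom f)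

@[simp] theorem evalOne_coe (f : A → M) (x : Pseudoword A) : evalOne f x = evalAt x f := rfl

theorem evalOne_comp (k : M →* N) (f : A → M) (x : WithOne (Pseudoword A)) :
    evalOne (fun a => k (f a)) x = k (evalOne f x) := by
  induction x with
  | one => simp
  | coe x => exact evalAt_comp k.toMulHom x f

open Classical in
/-- The valuation of the letters that detects the occurrence of `b`. -/
noncomputable def detect (b a : A) : ZMod 2 := if b = a then 0 else 1

/-- The content of a possibly empty pseudoword: the set of letters that occur in it. -/
def content (x : WithOne (Pseudoword A)) : Set A := {b | evalOne (detect b) x = 0}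

/-- The content of a possibly empty word. -/
def wordContent (x : WithOne (FreeSemigroup A)) : Set A := {b | wordEval (detect b) x = 0}

@[simp] theorem content_mul (x y : WithOne (Pseudoword A)) :
    content (x * y) = content x ∪ content y := by
  ext b
  simp [content]

@[simp] theorem wordContent_mul (x y : WithOne (FreeSemigroup A)) :
    wordContent (x * y) = wordContent x ∪ wordContent y := by
  ext b
  simp [wordContent]

@[simp] theorem content_one : content (1 : WithOne (Pseudoword A)) = ∅ := by
  ext b
  simp [content]

@[simp] theorem wordContent_one : wordContent (1 : WithOne (FreeSemigroup A)) = ∅ := by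
  ext b
  simp [wordContent]

@[simp] theorem content_letter (a : A) : content (letter a : WithOne (Pseudoword A)) = {a} := by
  ext b
  simp [content, detect]

@[simp] theorem wordContent_of (a : A) :
    wordContent (FreeSemigroup.of a : WithOne (FreeSemigroup A)) = {a} := by
  ext b
  simp [wordContent, detect]

@[simp] theorem content_omega (x : Pseudoword A) :
    content (omega x : WithOne (Pseudoword A)) = content x := by
  ext b
  have h : ∀ z : ZMod 2, IsIdempotentElem z := by unfold IsIdempotentElem; decide
  simp only [content, Set.mem_ofPred_eq, evalOne_coe, evalAt_omega]
  rw [idempotent_power_unique (omegaPow_mem _)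
    (Subsemigroup.subset_closure (Set.mem_singleton _)) (h _) (h _)]

theorem wordContent_nonempty (r : FreeSemigroup A) :
    (wordContent (r : WithOne (FreeSemigroup A))).Nonempty := by
  induction r with
  | ih1 i => exact ⟨i, by simp⟩
  | ih2 i r _ _ => exact ⟨i, by simp⟩

theorem exists_word_content [Finite A] {S : Type} [Semigroup S] [Finite S] (x : Pseudoword A)
    (f : A → S) : ∃ r, FreeSemigroup.lift f r = evalAt x f ∧
      wordContent (r : WithOne (FreeSemigroup A)) = content (x : WithOne (Pseudoword A)) := by
  obtain ⟨r, h1, h2⟩ := exists_word_pair x f (fun a b => detect b a)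
  refine ⟨r, h1, ?_⟩
  ext b
  have h3 := lift_comp (Pi.evalMulHom (fun _ : A => ZMod 2) b) (fun a b => detect b a) r
  have h4 := evalAt_comp (Pi.evalMulHom (fun _ : A => ZMod 2) b) x (fun a b => detect b a)
  rw [h2] at h3
  exact Iff.of_eq (congrArg (· = 0) (h3.trans h4.symm))

theorem content_nonempty [Finite A] (x : Pseudoword A) :
    (content (x : WithOne (Pseudoword A))).Nonempty := by
  obtain ⟨r, -, h⟩ := exists_word_content x (fun _ => ())
  exact h ▸ wordContent_nonempty r

theorem eq_one_of_content_eq_empty [Finite A] {x : WithOne (Pseudoword A)}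
    (h : content x = ∅) : x = 1 := by
  induction x with
  | one => rfl
  | coe x => exact absurd h (content_nonempty x).ne_empty

theorem withOne_pseudoword_ext {x y : WithOne (Pseudoword A)}
    (h : ∀ (M : Type) [Monoid M] [Finite M] (f : A → M), evalOne f x = evalOne f y) : x = y := by
  have hc : ∀ (x : Pseudoword A) (S : Type) [Semigroup S] [Finite S] (f : A → S)
      [Finite (WithOne S)],
      evalOne (fun a => (f a : WithOne S)) x = ((evalAt x f : S) : WithOne S) :=
    fun x S _ _ f _ => evalAt_comp (T := WithOne S) WithOne.coeMulHom x f
  have hfin : ∀ (S : Type) [Finite S], Finite (WithOne S) := fun S _ =>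
    inferInstanceAs (Finite (Option S))
  induction x with
  | one =>
    induction y with
    | one => rfl
    | coe y =>
      have := hfin Unit
      have h1 := h (WithOne Unit) fun _ => ((() : Unit) : WithOne Unit)
      rw [hc y Unit fun _ => ()] at h1
      exact absurd (h1.symm.trans (map_one _)) WithOne.coe_ne_one
  | coe x =>
    induction y with
    | one =>
      have := hfin Unit
      have h1 := h (WithOne Unit) fun _ => ((() : Unit) : WithOne Unit)
      rw [hc x Unit fun _ => ()] at h1
      exact absurd (h1.trans (map_one _)) WithOne.coe_ne_one
    | coe y =>
      refine congrArg _ (pseudoword_ext fun S _ _ f => WithOne.coe_injective ?_)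
      have := hfin S
      rw [← hc x S f, ← hc y S f]
      exact h _ _

end Content

/-! ### Factorizations of words at occurrences of letters. -/

section WordFactorization

variable {A : Type}

theorem word_first_occurrence (r : FreeSemigroup A) (a : A)
    (ha : a ∈ wordContent (r : WithOne (FreeSemigroup A))) :
    ∃ u v : WithOne (FreeSemigroup A), (r : WithOne (FreeSemigroup A)) = u * FreeSemigroup.of a * v ∧
      a ∉ wordContent u := by
  induction r with
  | ih1 i =>
    rw [wordContent_of, Set.mem_singleton_iff] at ha
    exact ⟨1, 1, by simp [ha], by simp⟩
  | ih2 i r _ ih =>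
    by_cases h : a = i
    · exact ⟨1, r, by simp [h], by simp⟩
    · obtain ⟨u, v, h1, h2⟩ := ih (by simpa [h] using ha)
      exact ⟨FreeSemigroup.of i * u, v, by rw [WithOne.coe_mul, h1]; simp only [mul_assoc],
        by simp [h, h2]⟩

theorem word_last_occurrence (r : FreeSemigroup A) (a : A)
    (ha : a ∈ wordContent (r : WithOne (FreeSemigroup A))) :
    ∃ u v : WithOne (FreeSemigroup A), (r : WithOne (FreeSemigroup A)) = u * FreeSemigroup.of a * v ∧
      a ∉ wordContent v := by
  induction r with
  | ih1 i =>
    rw [wordContent_of, Set.mem_singleton_iff] at ha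
    exact ⟨1, 1, by simp [ha], by simp⟩
  | ih2 i r _ ih =>
    by_cases h : a ∈ wordContent (r : WithOne (FreeSemigroup A))
    · obtain ⟨u, v, h1, h2⟩ := ih h
      exact ⟨FreeSemigroup.of i * u, v, by rw [WithOne.coe_mul, h1]; simp only [mul_assoc], h2⟩
    · have : a = i := by simpa [h] using ha
      exact ⟨1, r, by simp [this], h⟩

/-- D stands for the letters already read: the induction strips the first letter of the word and
adds it to D. -/
theorem word_left_basic_aux (r : FreeSemigroup A) (D : Set A)
    (hD : ¬ wordContent (r : WithOne (FreeSemigroup A)) ⊆ D) :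
    ∃ (u : WithOne (FreeSemigroup A)) (a : A) (v : WithOne (FreeSemigroup A)),
      (r : WithOne (FreeSemigroup A)) = u * FreeSemigroup.of a * v ∧
      a ∉ D ∪ wordContent u ∧
      wordContent (r : WithOne (FreeSemigroup A)) ⊆ insert a (D ∪ wordContent u) := by
  induction r generalizing D with
  | ih1 i =>
    exact ⟨1, i, 1, by simp, by simpa using hD, by simp⟩
  | ih2 i r _ ih =>
    by_cases h : wordContent (r : WithOne (FreeSemigroup A)) ⊆ insert i D
    · refine ⟨1, i, r, by simp, ?_, ?_⟩
      · intro hi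
        refine hD ?_
        simp only [wordContent_one, Set.union_empty] at hi
        rw [Set.insert_eq_of_mem hi] at h
        simpa [Set.insert_subset_iff, hi] using h
      · simpa [Set.insert_subset_iff] using h
    · obtain ⟨u, a, v, h1, h2, h3⟩ := ih _ h
      refine ⟨FreeSemigroup.of i * u, a, v, by rw [WithOne.coe_mul, h1]; simp only [mul_assoc],
        ?_, ?_⟩
      · simp only [Set.mem_union, Set.mem_insert_iff, not_or] at h2
        simp [h2]
      · intro b hb
        have := @h3 b
        simp only [WithOne.coe_mul, wordContent_mul, wordContent_of, Set.mem_union,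
          Set.mem_singleton_iff, Set.mem_insert_iff] at hb this ⊢
        tauto

theorem word_left_basic (r : FreeSemigroup A) :
    ∃ (u : WithOne (FreeSemigroup A)) (a : A) (v : WithOne (FreeSemigroup A)),
      (r : WithOne (FreeSemigroup A)) = u * FreeSemigroup.of a * v ∧ a ∉ wordContent u ∧
        wordContent (r : WithOne (FreeSemigroup A)) = insert a (wordContent u) := by
  obtain ⟨u, a, v, h1, h2, h3⟩ := word_left_basic_aux r ∅
    (by simpa [Set.subset_empty_iff] using (wordContent_nonempty r).ne_empty)
  rw [Set.empty_union] at h2 h3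
  refine ⟨u, a, v, h1, h2, h3.antisymm ?_⟩
  rw [h1]
  simp [Set.subset_def]
  tauto

theorem word_right_basic (r : FreeSemigroup A) :
    ∃ (u : WithOne (FreeSemigroup A)) (a : A) (v : WithOne (FreeSemigroup A)),
      (r : WithOne (FreeSemigroup A)) = u * FreeSemigroup.of a * v ∧ a ∉ wordContent v ∧
        wordContent (r : WithOne (FreeSemigroup A)) = insert a (wordContent v) := by
  induction r with
  | ih1 i => exact ⟨1, i, 1, by simp, by simp, by simp⟩
  | ih2 i r _ ih =>
    by_cases h : i ∈ wordContent (r : WithOne (FreeSemigroup A))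
    · obtain ⟨u, a, v, h1, h2, h3⟩ := ih
      refine ⟨FreeSemigroup.of i * u, a, v, by rw [WithOne.coe_mul, h1]; simp only [mul_assoc],
        h2, ?_⟩
      rw [← h3]
      simp [h]
    · exact ⟨1, i, r, by simp, h, by simp⟩

end WordFactorization

/-! ### Ultrafilter limits, and factorizations of pseudowords. -/

section Compactness

variable {A : Type}

/-- The congruences of finite index on the free semigroup. -/
abbrev FinCon (A : Type) : Type := {c : Con (FreeSemigroup A) // allFinite.Mem c.Quotient}

instance : IsCodirectedOrder (FinCon A) where
  directed c d := by
    let h : A → c.1.Quotient × d.1.Quotient := fun a =>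
      ((FreeSemigroup.of a : FreeSemigroup A), (FreeSemigroup.of a : FreeSemigroup A))
    refine ⟨⟨_, finite_ker h⟩, fun x y hxy => ?_, fun x y hxy => ?_⟩
    · have hxy : FreeSemigroup.lift h x = FreeSemigroup.lift h y := hxy
      have h1 : ∀ x, FreeSemigroup.lift _ x = (FreeSemigroup.lift h x).1 :=
        lift_comp (MulHom.fst c.1.Quotient d.1.Quotient) h
      refine (Con.eq c.1).1 ?_
      rw [← lift_coe, ← lift_coe]
      exact (h1 x).trans ((congrArg Prod.fst hxy).trans (h1 y).symm)
    · have hxy : FreeSemigroup.lift h x = FreeSemigroup.lift h y := hxy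
      have h1 : ∀ x, FreeSemigroup.lift _ x = (FreeSemigroup.lift h x).2 :=
        lift_comp (MulHom.snd c.1.Quotient d.1.Quotient) h
      refine (Con.eq d.1).1 ?_
      rw [← lift_coe, ← lift_coe]
      exact (h1 x).trans ((congrArg Prod.snd hxy).trans (h1 y).symm)

instance : Nonempty (FinCon A) := ⟨⟨_, finite_ker fun _ : A => ()⟩⟩

/-- An ultrafilter that contains the congruences below any given one. -/
noncomputable def fineUltrafilter (A : Type) : Ultrafilter (FinCon A) :=
  Ultrafilter.of Filter.atBot

theorem eventually_le_fineUltrafilter (d : FinCon A) : ∀ᶠ c in fineUltrafilter A, c ≤ d :=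
  Ultrafilter.of_le _ (Filter.eventually_le_atBot d)

theorem exists_eventually_eq_of_finite {X Y : Type} [Finite Y] (U : Ultrafilter X) (g : X → Y) :
    ∃ y, ∀ᶠ x in U, g x = y := by
  by_contra! h
  obtain ⟨x, hx⟩ := (Filter.eventually_all.2 h).exists
  exact hx _ rfl

/-- The limit of a net of words. -/
theorem exists_limit (g : FinCon A → FreeSemigroup A) : ∃ x : Pseudoword A,
    ∀ d : FinCon A, ∀ᶠ c in fineUltrafilter A, (g c : d.1.Quotient) = x.1 d := by
  have h : ∀ d : FinCon A, ∃ q : d.1.Quotient,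
      ∀ᶠ c in fineUltrafilter A, (g c : d.1.Quotient) = q :=
    fun d => exists_eventually_eq_of_finite _ _
  choose q hq using h
  refine ⟨⟨q, fun d e hde w hw => ?_⟩, hq⟩
  obtain ⟨c, h1, h2⟩ := ((hq d).and (hq e)).exists
  rw [← h2]
  rw [← h1] at hw
  exact (Con.eq e.1).2 (hde ((Con.eq d.1).1 hw))

theorem exists_limit_withOne (g : FinCon A → WithOne (FreeSemigroup A)) :
    ∃ x : WithOne (Pseudoword A), ∀ (M : Type) [Monoid M] [Finite M] (f : A → M),
      ∀ᶠ c in fineUltrafilter A, wordEval f (g c) = evalOne f x := by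
  by_cases h : ∀ᶠ c in fineUltrafilter A, g c = 1
  · refine ⟨1, fun M _ _ f => h.mono fun c hc => ?_⟩
    rw [hc, map_one, map_one]
  · rw [← Ultrafilter.eventually_not] at h
    obtain ⟨c₀, hc₀⟩ := h.exists
    -- The nonempty word `g c₀` serves as a default where `g c = 1`; such c are negligible for the
    -- ultrafilter.
    let w : FinCon A → FreeSemigroup A := fun c =>
      open Classical in if hc : g c = 1 then WithOne.unone hc₀ else WithOne.unone hc
    obtain ⟨x, hx⟩ := exists_limit w
    refine ⟨x, fun M _ _ f => ?_⟩
    filter_upwards [h, hx ⟨_, finite_ker f⟩] with c h1 h2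
    have : g c = w c := by simp [w, h1]
    rw [this, wordEval_coe, evalOne_coe, evalAt_eq x f _ h2]

/-- A factorization property of words that depends on contents only extends to pseudowords. -/
theorem exists_factorization [Finite A] (w : Pseudoword A) (Q : Set A → A → Set A → Prop)
    (h : ∀ r : FreeSemigroup A,
      wordContent (r : WithOne (FreeSemigroup A)) = content (w : WithOne (Pseudoword A)) →
      ∃ (u : WithOne (FreeSemigroup A)) (a : A) (v : WithOne (FreeSemigroup A)),
        (r : WithOne (FreeSemigroup A)) = u * FreeSemigroup.of a * v ∧
          Q (wordContent u) a (wordContent v)) :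
    ∃ (u : WithOne (Pseudoword A)) (a : A) (v : WithOne (Pseudoword A)),
      (w : WithOne (Pseudoword A)) = u * letter a * v ∧ Q (content u) a (content v) := by
  -- For each congruence c, factor a word that represents w modulo c. The limits of the factors
  -- multiply to w, and contents, being finite data, agree with those of the limits for some c.
  have h1 : ∀ c : FinCon A, ∃ (u : WithOne (FreeSemigroup A)) (a : A)
      (v : WithOne (FreeSemigroup A)) (r : FreeSemigroup A),
      (r : WithOne (FreeSemigroup A)) = u * FreeSemigroup.of a * v ∧
        Q (wordContent u) a (wordContent v) ∧ (r : c.1.Quotient) = w.1 c := by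
    intro c
    obtain ⟨r, h1, h2⟩ := exists_word_content w
      (fun a => ((FreeSemigroup.of a : FreeSemigroup A) : c.1.Quotient))
    obtain ⟨u, a, v, h3, h4⟩ := h r h2
    refine ⟨u, a, v, r, h3, h4, ?_⟩
    rw [lift_coe] at h1
    exact h1.trans (coord_eq_evalAt w c).symm
  choose u a v r hr hQ hw using h1
  obtain ⟨x, hx⟩ := exists_limit_withOne u
  obtain ⟨y, hy⟩ := exists_limit_withOne v
  obtain ⟨b, hb⟩ := exists_eventually_eq_of_finite (fineUltrafilter A) a
  refine ⟨x, b, y, withOne_pseudoword_ext fun M _ _ f => ?_, ?_⟩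
  · obtain ⟨c, h1, h2, h3, h4⟩ := ((hx M f).and ((hy M f).and (hb.and
      (eventually_le_fineUltrafilter ⟨_, finite_ker f⟩)))).exists
    rw [map_mul, map_mul, ← h1, ← h2, evalOne_coe, evalOne_coe, evalAt_letter, ← h3,
      evalAt_eq_lift w f c h4 _ (hw c), ← wordEval_coe, hr c, map_mul, map_mul, wordEval_coe,
      FreeSemigroup.lift_of]
  · have h2 : ∀ b : A, ∀ᶠ c in fineUltrafilter A,
        wordEval (detect b) (u c) = evalOne (detect b) x ∧
        wordEval (detect b) (v c) = evalOne (detect b) y :=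
      fun b => (hx _ _).and (hy _ _)
    obtain ⟨c, h3, h4⟩ := ((Filter.eventually_all.2 h2).and hb).exists
    have e1 : content x = wordContent (u c) := by
      ext b
      exact Iff.of_eq (congrArg (· = 0) (h3 b).1.symm)
    have e2 : content y = wordContent (v c) := by
      ext b
      exact Iff.of_eq (congrArg (· = 0) (h3 b).2.symm)
    rw [e1, e2, ← h4]
    exact hQ c

variable [Finite A]

theorem exists_first_occurrence (w : Pseudoword A) {a : A}
    (ha : a ∈ content (w : WithOne (Pseudoword A))) : ∃ u v : WithOne (Pseudoword A),
      (w : WithOne (Pseudoword A)) = u * letter a * v ∧ a ∉ content u := by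
  obtain ⟨u, b, v, h1, rfl, h2⟩ := exists_factorization w (fun u b _ => b = a ∧ a ∉ u)
    fun r hr => by
      obtain ⟨u, v, h1, h2⟩ := word_first_occurrence r a (hr ▸ ha)
      exact ⟨u, a, v, h1, rfl, h2⟩
  exact ⟨u, v, h1, h2⟩

theorem exists_last_occurrence (w : Pseudoword A) {a : A}
    (ha : a ∈ content (w : WithOne (Pseudoword A))) : ∃ u v : WithOne (Pseudoword A),
      (w : WithOne (Pseudoword A)) = u * letter a * v ∧ a ∉ content v := by
  obtain ⟨u, b, v, h1, rfl, h2⟩ := exists_factorization w (fun _ b v => b = a ∧ a ∉ v)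
    fun r hr => by
      obtain ⟨u, v, h1, h2⟩ := word_last_occurrence r a (hr ▸ ha)
      exact ⟨u, a, v, h1, rfl, h2⟩
  exact ⟨u, v, h1, h2⟩

/-- The left basic factorization of a pseudoword. -/
theorem exists_left_basic (w : Pseudoword A) :
    ∃ (u : WithOne (Pseudoword A)) (a : A) (v : WithOne (Pseudoword A)),
      (w : WithOne (Pseudoword A)) = u * letter a * v ∧ a ∉ content u ∧
        content (w : WithOne (Pseudoword A)) = insert a (content u) :=
  exists_factorization w (fun u a _ => a ∉ u ∧ content (w : WithOne (Pseudoword A)) = insert a u)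
    fun r hr => hr ▸ word_left_basic r

/-- The right basic factorization of a pseudoword. -/
theorem exists_right_basic (w : Pseudoword A) :
    ∃ (u : WithOne (Pseudoword A)) (a : A) (v : WithOne (Pseudoword A)),
      (w : WithOne (Pseudoword A)) = u * letter a * v ∧ a ∉ content v ∧
        content (w : WithOne (Pseudoword A)) = insert a (content v) :=
  exists_factorization w (fun _ a v => a ∉ v ∧ content (w : WithOne (Pseudoword A)) = insert a v)
    fun r hr => hr ▸ word_right_basic r

end Compactness

/-! ### Uniqueness over DO ∩ H̄ of the factorizations at first and last occurrences. -/

section Uniqueness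

variable {A : Type} {H : FinSemigroupClass}

/-- Equality of possibly empty pseudowords over the monoids in `V`. -/
def MonoidEq (V : FinSemigroupClass) (x y : WithOne (Pseudoword A)) : Prop :=
  ∀ (M : Type) [Monoid M] [Finite M], V.Mem M → ∀ f : A → M, evalOne f x = evalOne f y

theorem MonoidEq.refl {V : FinSemigroupClass} (x : WithOne (Pseudoword A)) : MonoidEq V x x :=
  fun _ _ _ _ _ => rfl

theorem MonoidEq.symm {V : FinSemigroupClass} {x y : WithOne (Pseudoword A)}
    (h : MonoidEq V x y) : MonoidEq V y x := fun M _ _ hM f => (h M hM f).symm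

theorem MonoidEq.trans {V : FinSemigroupClass} {x y z : WithOne (Pseudoword A)}
    (h : MonoidEq V x y) (h' : MonoidEq V y z) : MonoidEq V x z :=
  fun M _ _ hM f => (h M hM f).trans (h' M hM f)

theorem MonoidEq.mul {V : FinSemigroupClass} {x y z t : WithOne (Pseudoword A)}
    (h : MonoidEq V x y) (h' : MonoidEq V z t) : MonoidEq V (x * z) (y * t) :=
  fun M _ _ hM f => by rw [map_mul, map_mul, h M hM f, h' M hM f]

theorem monoidEq_coe_iff (hH : H.IsGroupPseudovariety) [Nonempty A] {x y : Pseudoword A} :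
    MonoidEq (classDOBar H) (x : WithOne (Pseudoword A)) y ↔
      proj (classDOBar H) A x = proj (classDOBar H) A y := by
  rw [proj_eq_iff (classDOBar_sub hH)]
  constructor
  · intro h S _ _ hS f
    have : Finite (WithOne S) := inferInstanceAs (Finite (Option S))
    have h1 := h (WithOne S) (classDOBar_withOne hH hS) fun a => f a
    simp only [evalOne_coe] at h1
    have h2 := fun z : Pseudoword A => evalAt_comp (T := WithOne S) WithOne.coeMulHom z f
    exact WithOne.coe_injective ((h2 x).symm.trans (h1.trans (h2 y)))
  · intro h M _ _ hM f
    exact h M hM f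

theorem MonoidEq.content_eq (hH : H.IsGroupPseudovariety) {x y : WithOne (Pseudoword A)}
    (h : MonoidEq (classDOBar H) x y) : content x = content y := by
  ext b
  exact Iff.of_eq (congrArg (· = 0) (h _ (classDOBar_zmod_two hH) (detect b)))

/-- Whether the distinguished letter occurs. -/
def Split.occHom (M : Type) [Monoid M] : Split M →* ZMod 2 where
  toFun x := if x.occ.isNone then 1 else 0
  map_one' := rfl
  map_mul' := by
    rintro ⟨m, _ | ⟨p, r, q, s⟩⟩ ⟨m', _ | ⟨p', r', q', s'⟩⟩ <;> rfl

open Classical in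
/-- The valuation in `Split M` with distinguished letter `a`. -/
noncomputable def splitVal {M : Type} [Monoid M] (f : A → M) (a b : A) : Split M :=
  ⟨f b, if a = b then some (1, 1, 1, 1) else none⟩

theorem val_splitVal {M : Type} [Monoid M] [Finite M] (f : A → M) (a : A)
    (u : WithOne (Pseudoword A)) : (evalOne (splitVal f a) u).val = evalOne f u :=
  (evalOne_comp (Split.valHom : Split M →* M) (splitVal f a) u).symm

theorem eval_splitVal {M : Type} [Monoid M] [Finite M] (f : A → M) {a : A}
    {u : WithOne (Pseudoword A)} (ha : a ∉ content u) :
    evalOne (splitVal f a) u = ⟨evalOne f u, none⟩ := by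
  refine Split.ext (val_splitVal f a u) ?_
  have h1 := evalOne_comp (Split.occHom M) (splitVal f a) u
  have h2 : (fun b => Split.occHom M (splitVal f a b)) = detect a := by
    funext b
    by_cases h : a = b <;> simp [Split.occHom, splitVal, detect, h]
  rw [h2] at h1
  by_contra h
  refine ha (h1.trans ?_)
  simp [Split.occHom, h]

theorem eval_splitVal_letter {M : Type} [Monoid M] [Finite M] (f : A → M) (a : A) :
    evalOne (splitVal f a) (letter a : Pseudoword A) = ⟨f a, some (1, 1, 1, 1)⟩ := by
  rw [evalOne_coe, evalAt_letter]
  simp [splitVal]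

/-- `Split M` stays in DO ∩ H̄ when M is there. Evaluation in it with distinguished letter a shows
the values of u and v as the first two components of the record. -/
theorem first_occurrence_unique (hH : H.IsGroupPseudovariety) {a : A}
    {u v u' v' : WithOne (Pseudoword A)}
    (h : MonoidEq (classDOBar H) (u * (letter a : WithOne (Pseudoword A)) * v)
      (u' * (letter a : WithOne (Pseudoword A)) * v'))
    (hu : a ∉ content u) (hu' : a ∉ content u') :
    MonoidEq (classDOBar H) u u' ∧ MonoidEq (classDOBar H) v v' := by
  have key : ∀ (M : Type) [Monoid M] [Finite M], (classDOBar H).Mem M → ∀ f : A → M,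
      evalOne f u = evalOne f u' ∧ evalOne f v = evalOne f v' := by
    intro M _ _ hM f
    have h1 := h (Split M) (Split.classDOBar_mem hH hM) (splitVal f a)
    simp only [map_mul, eval_splitVal f hu, eval_splitVal f hu', eval_splitVal_letter,
      Split.none_mul_some] at h1
    rw [← val_splitVal f a v, ← val_splitVal f a v']
    generalize evalOne (splitVal f a) v = x, evalOne (splitVal f a) v' = y at h1 ⊢
    obtain ⟨m, _ | ⟨p, r, q, s⟩⟩ := x <;> obtain ⟨m', _ | ⟨p', r', q', s'⟩⟩ := y <;>
      simp [Split.some_mul_none, Split.some_mul_some] at h1 <;> simp [h1]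
  exact ⟨fun M _ _ hM f => (key M hM f).1, fun M _ _ hM f => (key M hM f).2⟩

theorem last_occurrence_unique (hH : H.IsGroupPseudovariety) {a : A}
    {u v u' v' : WithOne (Pseudoword A)}
    (h : MonoidEq (classDOBar H) (u * (letter a : WithOne (Pseudoword A)) * v)
      (u' * (letter a : WithOne (Pseudoword A)) * v'))
    (hv : a ∉ content v) (hv' : a ∉ content v') :
    MonoidEq (classDOBar H) u u' ∧ MonoidEq (classDOBar H) v v' := by
  have key : ∀ (M : Type) [Monoid M] [Finite M], (classDOBar H).Mem M → ∀ f : A → M,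
      evalOne f u = evalOne f u' ∧ evalOne f v = evalOne f v' := by
    intro M _ _ hM f
    have h1 := h (Split M) (Split.classDOBar_mem hH hM) (splitVal f a)
    simp only [map_mul, eval_splitVal f hv, eval_splitVal f hv', eval_splitVal_letter] at h1
    rw [← val_splitVal f a u, ← val_splitVal f a u']
    generalize evalOne (splitVal f a) u = x, evalOne (splitVal f a) u' = y at h1 ⊢
    obtain ⟨m, _ | ⟨p, r, q, s⟩⟩ := x <;> obtain ⟨m', _ | ⟨p', r', q', s'⟩⟩ := y <;>
      simp [Split.none_mul_some, Split.some_mul_none, Split.some_mul_some] at h1 <;> tauto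
  exact ⟨fun M _ _ hM f => (key M hM f).1, fun M _ _ hM f => (key M hM f).2⟩

end Uniqueness

/-! ### Local groups in DO, and words enclosed between ω-powers. -/

section Regular

variable {A T : Type} [Semigroup T]

/-- The values of the words with content contained in `B`. -/
def subValues (f : A → T) (B : Set A) : Set T :=
  {t | ∃ r : FreeSemigroup A, wordContent (r : WithOne (FreeSemigroup A)) ⊆ B ∧ FreeSemigroup.lift f r = t}

/-- The values of the words with content `B`. -/
def fullValues (f : A → T) (B : Set A) : Set T :=
  {t | ∃ r : FreeSemigroup A, wordContent (r : WithOne (FreeSemigroup A)) = B ∧ FreeSemigroup.lift f r = t}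

variable {f : A → T} {B : Set A}

theorem subValues_of_fullValues {t : T} (h : t ∈ fullValues f B) : t ∈ subValues f B := by
  obtain ⟨r, h, h'⟩ := h
  exact ⟨r, h.le, h'⟩

theorem subValues_mul {s t : T} (hs : s ∈ subValues f B) (ht : t ∈ subValues f B) :
    s * t ∈ subValues f B := by
  obtain ⟨r, h, rfl⟩ := hs
  obtain ⟨r', h', rfl⟩ := ht
  exact ⟨r * r', by simp [h, h'], map_mul _ _ _⟩

theorem fullValues_mul_left {s t : T} (hs : s ∈ fullValues f B) (ht : t ∈ subValues f B) :
    s * t ∈ fullValues f B := by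
  obtain ⟨r, h, rfl⟩ := hs
  obtain ⟨r', h', rfl⟩ := ht
  exact ⟨r * r', by simpa [h] using h', map_mul _ _ _⟩

theorem fullValues_mul_right {s t : T} (hs : s ∈ subValues f B) (ht : t ∈ fullValues f B) :
    s * t ∈ fullValues f B := by
  obtain ⟨r, h, rfl⟩ := hs
  obtain ⟨r', h', rfl⟩ := ht
  exact ⟨r * r', by simpa [h'] using h, map_mul _ _ _⟩

theorem fullValues_mul {s t : T} (hs : s ∈ fullValues f B) (ht : t ∈ fullValues f B) :
    s * t ∈ fullValues f B := fullValues_mul_left hs (subValues_of_fullValues ht)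

/-- An idempotent value of a word with content `B` factors at each letter of `B`. -/
theorem exists_factors_at_letter {e : T} (he : e ∈ fullValues f B) (hee : IsIdempotentElem e)
    {a : A} (ha : a ∈ B) : ∃ p ∈ fullValues f B, ∃ q ∈ fullValues f B, q * e = q ∧
      p * f a * q = e := by
  have hE := he
  obtain ⟨r, hr, hre⟩ := he
  obtain ⟨u, v, huv, -⟩ := word_first_occurrence r a (hr ▸ ha)
  have hc := lift_comp (WithOne.coeMulHom : T →ₙ* WithOne T) f
  have hB : wordContent u ⊆ B ∧ wordContent v ⊆ B := by
    rw [huv] at hr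
    rw [← hr]
    constructor <;> intro b hb <;> simp [hb]
  have h1 : ∃ p ∈ fullValues f B, (p : WithOne T) = e * wordEval (fun a => (f a : WithOne T)) u := by
    induction u with
    | one => exact ⟨e, hE, by simp⟩
    | coe u =>
      refine ⟨e * FreeSemigroup.lift f u, fullValues_mul_left hE ⟨u, hB.1, rfl⟩, ?_⟩
      rw [WithOne.coe_mul, wordEval_coe]
      exact congrArg ((e : WithOne T) * ·) (hc u).symm
  have h2 : ∃ p ∈ fullValues f B, (p : WithOne T) = wordEval (fun a => (f a : WithOne T)) v * e := by
    induction v with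
    | one => exact ⟨e, hE, by simp⟩
    | coe u =>
      refine ⟨FreeSemigroup.lift f u * e, fullValues_mul_right ⟨u, hB.2, rfl⟩ hE, ?_⟩
      rw [WithOne.coe_mul, wordEval_coe]
      exact congrArg (· * (e : WithOne T)) (hc u).symm
  obtain ⟨p, hp, hpe⟩ := h1
  obtain ⟨q, hq, hqe⟩ := h2
  have ee : (e : WithOne T) * e = e := by rw [← WithOne.coe_mul, hee.eq]
  refine ⟨p, hp, q, hq, WithOne.coe_injective ?_, WithOne.coe_injective ?_⟩
  · rw [WithOne.coe_mul, hqe, mul_assoc, ee]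
  · have hk := congrArg (wordEval fun a => (f a : WithOne T)) huv
    rw [map_mul, map_mul, wordEval_coe, wordEval_coe, FreeSemigroup.lift_of] at hk
    have h3 := (hc r).symm.trans hk
    rw [hre] at h3
    change (e : WithOne T) = _ at h3
    rw [WithOne.coe_mul, WithOne.coe_mul, hpe, hqe]
    calc _ = (e : WithOne T) * (wordEval (fun a => (f a : WithOne T)) u * f a *
          wordEval (fun a => (f a : WithOne T)) v) * e := by simp only [mul_assoc]
      _ = e := by rw [← h3, ee, ee]

/-- With e = p f(a) q and q e = q, the cyclic shift f(a) q p is an idempotent J-equivalent to e, so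
e f(a) q p e = e. -/
theorem exists_mul_letter_mul_eq (hT : RectangularIdempotents T) {e : T}
    (he : e ∈ fullValues f B) (hee : IsIdempotentElem e) {a : A} (ha : a ∈ B) :
    ∃ t ∈ fullValues f B, e * f a * t = e := by
  obtain ⟨p, hp, q, hq, hqe, h⟩ := exists_factors_at_letter he hee ha
  have hi : IsIdempotentElem (f a * q * p) := by
    unfold IsIdempotentElem
    calc f a * q * p * (f a * q * p) = f a * q * (p * f a * q) * p := by simp only [mul_assoc]
      _ = f a * (q * e) * p := by rw [h]; simp only [mul_assoc]
      _ = _ := by rw [hqe]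
  have hJ : JEquiv e (f a * q * p) := by
    refine ⟨⟨p, (f a * q : T), ?_⟩, ⟨(f a * q : T), p, ?_⟩⟩ <;>
      simp only [← WithOne.coe_mul] <;> refine congrArg _ ?_
    · rw [← hee.eq, ← h]
      simp only [mul_assoc]
    · rw [mul_assoc (f a) q e, hqe]
  refine ⟨q * p * e, fullValues_mul (fullValues_mul hq hp) he, ?_⟩
  have := hT e _ hee hi hJ
  simpa only [mul_assoc] using this

/-- Induction on the word: if e f(a) t = e for its first letter a, the rest of the word is read from
the idempotent t e f(a), again a value of content B. -/
theorem exists_mul_subValues_mul_eq (hT : RectangularIdempotents T) {e x : T}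
    (he : e ∈ fullValues f B) (hee : IsIdempotentElem e) (hx : x ∈ subValues f B) :
    ∃ t ∈ fullValues f B, e * x * t = e := by
  obtain ⟨r, hr, rfl⟩ := hx
  induction r generalizing e with
  | ih1 a =>
    rw [FreeSemigroup.lift_of]
    exact exists_mul_letter_mul_eq hT he hee (by simpa using hr)
  | ih2 a r _ ih =>
    rw [WithOne.coe_mul, wordContent_mul, wordContent_of, Set.union_subset_iff,
      Set.singleton_subset_iff] at hr
    obtain ⟨t, ht, h1⟩ := exists_mul_letter_mul_eq hT he hee hr.1
    have hfa : f a ∈ subValues f B := ⟨FreeSemigroup.of a, by simpa using hr.1, by simp⟩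
    have hi : IsIdempotentElem (t * e * f a) := by
      unfold IsIdempotentElem
      calc t * e * f a * (t * e * f a) = t * (e * f a * t) * e * f a := by simp only [mul_assoc]
        _ = _ := by rw [h1, mul_assoc t e e, hee.eq]
    obtain ⟨t', ht', h2⟩ := ih (fullValues_mul_left (fullValues_mul ht he) hfa) hi hr.2
    refine ⟨t' * t, fullValues_mul ht' ht, ?_⟩
    rw [map_mul, FreeSemigroup.lift_of]
    calc e * (f a * FreeSemigroup.lift f r) * (t' * t)
        = (e * f a * t) * (e * f a) * FreeSemigroup.lift f r * t' * t := by
          rw [h1, ← mul_assoc e e, hee.eq]; simp only [mul_assoc]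
      _ = e * f a * (t * e * f a * FreeSemigroup.lift f r * t') * t := by simp only [mul_assoc]
      _ = (e * f a * t) * (e * f a * t) := by rw [h2]; simp only [mul_assoc]
      _ = e := by rw [h1, hee.eq]

/-- The relations e g t = e and g e t' = g make e and g J-equivalent. -/
theorem fullValues_rectangular (hT : RectangularIdempotents T) {e g : T}
    (he : e ∈ fullValues f B) (hee : IsIdempotentElem e) (hg : g ∈ fullValues f B)
    (hgg : IsIdempotentElem g) : e * g * e = e := by
  obtain ⟨t, -, h⟩ := exists_mul_subValues_mul_eq hT he hee (subValues_of_fullValues hg)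
  obtain ⟨t', -, h'⟩ := exists_mul_subValues_mul_eq hT hg hgg (subValues_of_fullValues he)
  exact hT e g hee hgg ⟨⟨e, t, by rw [← WithOne.coe_mul, ← WithOne.coe_mul, h]⟩,
    ⟨g, t', by rw [← WithOne.coe_mul, ← WithOne.coe_mul, h']⟩⟩

/-- This makes x ↦ e x e multiplicative on values of content in B. An idempotent k of content B is
absorbed by e x on the right, another one l by y e on the left, and k e l = k l because idempotents
of content B behave as in a rectangular band. -/
theorem idempotent_mul_subValues (hT : RectangularIdempotents T) {e x y : T}
    (he : e ∈ fullValues f B) (hee : IsIdempotentElem e) (hx : x ∈ subValues f B)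
    (hy : y ∈ subValues f B) : e * x * e * y * e = e * x * y * e := by
  obtain ⟨t, ht, h⟩ := exists_mul_subValues_mul_eq hT he hee hx
  obtain ⟨s, hs, h'⟩ := exists_mul_subValues_mul_eq hT he hee hy
  have rect : ∀ g ∈ fullValues f B, ∀ h ∈ fullValues f B, IsIdempotentElem g →
      IsIdempotentElem h → g * h * g = g ∧ IsIdempotentElem (g * h) := by
    intro g hg h hh hgg hhh
    have := fullValues_rectangular hT hg hgg hh hhh
    refine ⟨this, ?_⟩
    unfold IsIdempotentElem
    rw [← mul_assoc, this]
  obtain ⟨k, hk, hkk, hxk⟩ : ∃ k ∈ fullValues f B, IsIdempotentElem k ∧ e * x * k = e * x := by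
    refine ⟨t * e * x, fullValues_mul_left (fullValues_mul ht he) hx, ?_, ?_⟩
    · unfold IsIdempotentElem
      calc t * e * x * (t * e * x) = t * (e * x * t) * e * x := by simp only [mul_assoc]
        _ = _ := by rw [h, mul_assoc t e e, hee.eq]
    · calc e * x * (t * e * x) = e * x * t * e * x := by simp only [mul_assoc]
        _ = _ := by rw [h, hee.eq]
  obtain ⟨l, hl, hll, hly⟩ : ∃ l ∈ fullValues f B, IsIdempotentElem l ∧ l * (y * e) = y * e := by
    have hi : IsIdempotentElem (s * e * y) := by
      unfold IsIdempotentElem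
      calc s * e * y * (s * e * y) = s * (e * y * s) * e * y := by simp only [mul_assoc]
        _ = _ := by rw [h', mul_assoc s e e, hee.eq]
    have h1 := (rect e he _ (fullValues_mul_left (fullValues_mul hs he) hy) hee hi).1
    refine ⟨y * e * s * e, fullValues_mul (fullValues_mul (fullValues_mul_right hy he) hs) he,
      ?_, ?_⟩
    · unfold IsIdempotentElem
      calc y * e * s * e * (y * e * s * e) = y * (e * (s * e * y) * e) * s * e := by
            simp only [mul_assoc]
        _ = _ := by rw [h1]
    · calc y * e * s * e * (y * e) = y * (e * (s * e * y) * e) := by simp only [mul_assoc]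
        _ = _ := by rw [h1]
  obtain ⟨h1, h2⟩ := rect k hk l hl hkk hll
  obtain ⟨h3, -⟩ := rect l hl k hk hll hkk
  obtain ⟨-, h4⟩ := rect k hk e he hkk hee
  obtain ⟨-, h5⟩ := rect _ (fullValues_mul hk he) l hl h4 hll
  obtain ⟨h6, -⟩ := rect _ (fullValues_mul hk hl) _ (fullValues_mul (fullValues_mul hk he) hl) h2 h5
  have h7 : k * e * l = k * l := by
    calc k * e * l = (k * l * k) * e * (l * k * l) := by rw [h1, h3]
      _ = k * l * (k * e * l) * (k * l) := by simp only [mul_assoc]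
      _ = _ := h6
  calc e * x * e * y * e = (e * x * k) * e * (l * (y * e)) := by
        rw [hxk, hly]; simp only [mul_assoc]
    _ = (e * x) * (k * e * l) * (y * e) := by simp only [mul_assoc]
    _ = (e * x * k) * (l * (y * e)) := by rw [h7]; simp only [mul_assoc]
    _ = _ := by rw [hxk, hly]; simp only [mul_assoc]

/-- This moves s into the group at e even when the idempotent g on the right differs from e. -/
theorem idempotent_mul_subValues_mul_idempotent (hT : RectangularIdempotents T) {e g s : T}
    (he : e ∈ fullValues f B) (hee : IsIdempotentElem e) (hg : g ∈ fullValues f B)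
    (hgg : IsIdempotentElem g) (hs : s ∈ subValues f B) : e * s * g = e * s * e * g := by
  have h1 := fullValues_rectangular hT hg hgg he hee
  have h2 := idempotent_mul_subValues hT he hee hs (subValues_of_fullValues hg)
  calc e * s * g = (e * s * g * e) * g := by
        conv_lhs => rw [← h1]
        simp only [mul_assoc]
    _ = e * s * e * (g * e * g) := by rw [← h2]; simp only [mul_assoc]
    _ = _ := by rw [h1]

/-- The group `e T_B e`, where `T_B` consists of the values of words with content contained
in `B`. -/
def localGroup (hT : RectangularIdempotents T) {e : T} (he : e ∈ fullValues f B)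
    (hee : IsIdempotentElem e) : Subsemigroup T where
  carrier := {t | ∃ x ∈ subValues f B, t = e * x * e}
  mul_mem' := by
    rintro _ _ ⟨x, hx, rfl⟩ ⟨y, hy, rfl⟩
    refine ⟨x * y, subValues_mul hx hy, ?_⟩
    have := idempotent_mul_subValues hT he hee hx hy
    calc e * x * e * (e * y * e) = e * x * (e * e) * y * e := by simp only [mul_assoc]
      _ = _ := by rw [hee.eq, this]; simp only [mul_assoc]

theorem isGroupSemigroup_localGroup (hT : RectangularIdempotents T) {e : T}
    (he : e ∈ fullValues f B) (hee : IsIdempotentElem e) :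
    IsGroupSemigroup (localGroup hT he hee) := by
  refine IsGroupSemigroup.of_identity ⟨e, e, subValues_of_fullValues he, by rw [hee.eq, hee.eq]⟩
    ?_ ?_
  · rintro ⟨_, x, hx, rfl⟩
    refine Subtype.ext ?_
    change e * x * e * e = e * x * e
    rw [mul_assoc _ e e, hee.eq]
  · rintro ⟨_, x, hx, rfl⟩
    obtain ⟨t, ht, h⟩ := exists_mul_subValues_mul_eq hT he hee hx
    refine ⟨⟨_, t, subValues_of_fullValues ht, rfl⟩, Subtype.ext ?_⟩
    have := idempotent_mul_subValues hT he hee hx (subValues_of_fullValues ht)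
    change e * x * e * (e * t * e) = e
    calc e * x * e * (e * t * e) = e * x * (e * e) * t * e := by simp only [mul_assoc]
      _ = e := by rw [hee.eq, this, h, hee.eq]

open Classical in
/-- The valuation `a ↦ e f(a) e` of the letters of `B` in the group `e T_B e`. -/
noncomputable def localVal (hT : RectangularIdempotents T) {e : T} (he : e ∈ fullValues f B)
    (hee : IsIdempotentElem e) (a : A) : localGroup hT he hee :=
  if ha : a ∈ B then ⟨e * f a * e, f a, ⟨FreeSemigroup.of a, by simpa using ha, by simp⟩, rfl⟩
  else ⟨e * e * e, e, subValues_of_fullValues he, rfl⟩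

theorem lift_localVal (hT : RectangularIdempotents T) {e : T} (he : e ∈ fullValues f B)
    (hee : IsIdempotentElem e) {r : FreeSemigroup A}
    (hr : wordContent (r : WithOne (FreeSemigroup A)) ⊆ B) :
    (FreeSemigroup.lift (localVal hT he hee) r : T) = e * FreeSemigroup.lift f r * e := by
  induction r with
  | ih1 a =>
    have ha : a ∈ B := by simpa using hr
    simp [localVal, ha]
  | ih2 a r _ ih =>
    rw [WithOne.coe_mul, wordContent_mul, wordContent_of, Set.union_subset_iff,
      Set.singleton_subset_iff] at hr
    have hfa : f a ∈ subValues f B := ⟨FreeSemigroup.of a, by simpa using hr.1, by simp⟩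
    have := idempotent_mul_subValues hT he hee hfa ⟨r, hr.2, rfl⟩
    rw [map_mul, map_mul, MulMemClass.coe_mul, ih hr.2]
    simp only [FreeSemigroup.lift_of, localVal, hr.1, dif_pos]
    calc e * f a * e * (e * FreeSemigroup.lift f r * e)
        = e * f a * (e * e) * FreeSemigroup.lift f r * e := by simp only [mul_assoc]
      _ = _ := by rw [hee.eq, this]; simp only [mul_assoc]

variable [Finite A] {H : FinSemigroupClass}

/-- In T, let e and g be the values of m^ω and n^ω. The value of m^ω s n^ω is that of s in the local
group e T_B e, under a ↦ e f(a) e, multiplied by g. That group is a subgroup of T, hence in H, so s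
matters only over H. -/
theorem omega_mul_mul_omega_eq [Nonempty A] (hH : H.IsGroupPseudovariety) {m n s z : Pseudoword A}
    (hmn : content (m : WithOne (Pseudoword A)) = content (n : WithOne (Pseudoword A)))
    (hs : content (s : WithOne (Pseudoword A)) ⊆ content (m : WithOne (Pseudoword A)))
    (hz : content (z : WithOne (Pseudoword A)) ⊆ content (m : WithOne (Pseudoword A)))
    (h : proj H A s = proj H A z) :
    proj (classDOBar H) A (omega m * s * omega n) =
      proj (classDOBar H) A (omega m * z * omega n) := by
  rw [proj_eq_iff hH.isPseudovariety.sub] at h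
  rw [proj_eq_iff (classDOBar_sub hH)]
  intro T _ _ hT f
  obtain ⟨-, hT, hT'⟩ := classDOBar_mem_iff.1 hT
  set B := content (m : WithOne (Pseudoword A))
  have full : ∀ x : Pseudoword A, content (x : WithOne (Pseudoword A)) = B →
      evalAt x f ∈ fullValues f B := fun x hx => by
    obtain ⟨r, h1, h2⟩ := exists_word_content x f
    exact ⟨r, h2.trans hx, h1⟩
  have he := full (omega m) (content_omega m)
  have hg := full (omega n) ((content_omega n).trans hmn.symm)
  have idem : ∀ x : Pseudoword A, IsIdempotentElem (evalAt (omega x) f) := fun x => by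
    rw [evalAt_omega]
    exact isIdempotentElem_omegaPow _
  have key : ∀ x : Pseudoword A, content (x : WithOne (Pseudoword A)) ⊆ B →
      evalAt (omega m * x * omega n) f =
        ((evalAt x (localVal hT he (idem m)) : localGroup hT he (idem m)) : T) * evalAt (omega n) f := fun x hx => by
    obtain ⟨r, hr, h2⟩ := exists_word_content x (fun a => (f a, localVal hT he (idem m) a))
    have h3 := lift_comp (MulHom.fst T (localGroup hT he (idem m)))
      (fun a => (f a, localVal hT he (idem m) a)) r
    have h4 := lift_comp (MulHom.snd T (localGroup hT he (idem m)))
      (fun a => (f a, localVal hT he (idem m) a)) r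
    have h5 := evalAt_comp (MulHom.fst T (localGroup hT he (idem m))) x
      (fun a => (f a, localVal hT he (idem m) a))
    have h6 := evalAt_comp (MulHom.snd T (localGroup hT he (idem m))) x
      (fun a => (f a, localVal hT he (idem m) a))
    rw [hr] at h3 h4
    have h7 : evalAt x f = FreeSemigroup.lift f r := h5.trans h3.symm
    have h8 : evalAt x (localVal hT he (idem m)) =
      FreeSemigroup.lift (localVal hT he (idem m)) r := h6.trans h4.symm
    rw [evalAt_mul, evalAt_mul, h8, lift_localVal hT he (idem m) (h2.le.trans hx), h7]
    exact idempotent_mul_subValues_mul_idempotent hT he (idem m) hg (idem n)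
      ⟨r, h2.le.trans hx, rfl⟩
  rw [key s hs, key z hz, h _ (hT'.2 _ (isGroupSemigroup_localGroup hT he (idem m)))]

end Regular

/-! ### Cancellation and ω-powers over H. -/

section Projections

variable {A : Type} [Nonempty A] {H : FinSemigroupClass}

theorem IsGroupSemigroup.mul_right_cancel {S : Type} [Semigroup S] (h : IsGroupSemigroup S)
    {a b c : S} (hab : b * a = c * a) : b = c := by
  obtain ⟨K, _, ⟨i⟩⟩ := h
  have := congrArg i hab
  rw [map_mul, map_mul] at this
  exact i.injective (_root_.mul_right_cancel this)

theorem proj_left_cancel (hH : H.IsGroupPseudovariety) {x y z : Pseudoword A}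
    (h : proj H A (x * y) = proj H A (x * z)) : proj H A y = proj H A z := by
  rw [proj_eq_iff hH.isPseudovariety.sub] at h ⊢
  intro G _ _ hG f
  have := h G hG f
  rw [evalAt_mul, evalAt_mul] at this
  exact (hH.isGroup G hG).mul_left_cancel this

theorem proj_right_cancel (hH : H.IsGroupPseudovariety) {x y z : Pseudoword A}
    (h : proj H A (y * x) = proj H A (z * x)) : proj H A y = proj H A z := by
  rw [proj_eq_iff hH.isPseudovariety.sub] at h ⊢
  intro G _ _ hG f
  have := h G hG f
  rw [evalAt_mul, evalAt_mul] at this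
  exact (hH.isGroup G hG).mul_right_cancel this

theorem isIdempotentElem_omega {A : Type} (x : Pseudoword A) : IsIdempotentElem (omega x) :=
  pseudoword_ext fun S _ _ f => by
    rw [evalAt_mul, evalAt_omega]
    exact isIdempotentElem_omegaPow _

theorem proj_omega_mul {A : Type} (hH : H.IsGroupPseudovariety) (x : freePro H A)
    (y : Pseudoword A) : proj H A (omega y) * x = x := by
  refine Subtype.ext (funext fun c => ?_)
  have h := (isIdempotentElem_omega y).map (proj H A)
  exact (hH.isGroup _ c.2).idempotent_mul (congrFun (congrArg Subtype.val h) c) (x.1 c)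

theorem proj_omega_congr (hH : H.IsGroupPseudovariety) {x y : Pseudoword A}
    (h : proj (classDOBar H) A x = proj (classDOBar H) A y) :
    proj (classDOBar H) A (omega x) = proj (classDOBar H) A (omega y) := by
  rw [proj_eq_iff (classDOBar_sub hH)] at h ⊢
  intro T _ _ hT f
  rw [evalAt_omega, evalAt_omega, h T hT f]

theorem proj_group_of_proj (hH : H.IsGroupPseudovariety) {x y : Pseudoword A}
    (h : proj (classDOBar H) A x = proj (classDOBar H) A y) : proj H A x = proj H A y := by
  rw [proj_eq_iff (classDOBar_sub hH)] at h
  rw [proj_eq_iff hH.isPseudovariety.sub]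
  exact fun G _ _ hG f => h G (classDOBar_of_group hH hG) f

end Projections

/-! ### Uniform families and their approximation. -/

section Families

variable {A I S : Type} [Semigroup S]

/-- The members of the family `w` have the same projection over `V`. -/
def Uniform (V : FinSemigroupClass) (w : I → Pseudoword A) : Prop :=
  ∀ i j, proj V A (w i) = proj V A (w j)

theorem Uniform.mul {V : FinSemigroupClass} {u v : I → Pseudoword A} (hu : Uniform V u)
    (hv : Uniform V v) : Uniform V (u * v) := fun i j => by
  rw [Pi.mul_apply, Pi.mul_apply, map_mul, map_mul, hu i j, hv i j]

theorem Uniform.group [Nonempty A] {H : FinSemigroupClass} (hH : H.IsGroupPseudovariety)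
    {w : I → Pseudoword A} (hw : Uniform (classDOBar H) w) : Uniform H w :=
  fun i j => proj_group_of_proj hH (hw i j)

theorem Uniform.content_eq [Nonempty A] {H : FinSemigroupClass} (hH : H.IsGroupPseudovariety)
    {w : I → Pseudoword A} (hw : Uniform (classDOBar H) w) (i j : I) :
    content (w i : WithOne (Pseudoword A)) = content (w j : WithOne (Pseudoword A)) :=
  ((monoidEq_coe_iff hH).2 (hw i j)).content_eq hH

/-- Multiplication on the right by the `i`-th members of the families in a list. -/
def act (l : List (I → Pseudoword A)) (i : I) (x : Pseudoword A) : Pseudoword A :=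
  l.foldl (fun x e => x * e i) x

@[simp] theorem act_nil (i : I) (x : Pseudoword A) : act [] i x = x := rfl

@[simp] theorem act_cons (e : I → Pseudoword A) (l : List (I → Pseudoword A)) (i : I)
    (x : Pseudoword A) : act (e :: l) i x = act l i (x * e i) := rfl

@[simp] theorem act_append (l l' : List (I → Pseudoword A)) (i : I) (x : Pseudoword A) :
    act (l ++ l') i x = act l' i (act l i x) := List.foldl_append

theorem proj_act_congr {V : FinSemigroupClass} (l : List (I → Pseudoword A)) (i : I)
    {x y : Pseudoword A} (h : proj V A x = proj V A y) :
    proj V A (act l i x) = proj V A (act l i y) := by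
  induction l generalizing x y with
  | nil => exact h
  | cons e l ih => exact ih (by rw [map_mul, map_mul, h])

/-- The family `e'` of `σ`-words is uniform over `H` and has the same values as `e` under `φ`. -/
def IsReplacement (H : FinSemigroupClass) (σ : ImplicitSignature) (φ : OntoHom A S)
    (e e' : I → Pseudoword A) : Prop :=
  (∀ i, SigmaWord σ A (e' i)) ∧ (∀ i, φ.hom (e' i) = φ.hom (e i)) ∧ Uniform H e'

/-- The family `w` can be approximated by families of words over `σ ∪ {ω}` that are uniform over
`DO ∩ H̄` as soon as the families of a suitable list, whose product agrees with `w` over `H`, are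
replaced by `σ`-words. In the presence of `b`, approximations that are idempotent over `H` are
idempotent over `DO ∩ H̄`. -/
def Approximable (H : FinSemigroupClass) (σ : ImplicitSignature) (φ : OntoHom A S) (b : Prop)
    (w : I → Pseudoword A) : Prop :=
  ∃ l : List (I → Pseudoword A), (∀ e ∈ l, Uniform H e) ∧
    (∀ i x, proj H A (x * w i) = proj H A (act l i x)) ∧
    ∀ l', List.Forall₂ (IsReplacement H σ φ) l l' → ∃ w' : I → Pseudoword A,
      (∀ i, SigmaWord σ.addOmega A (w' i)) ∧ (∀ i, φ.hom (w' i) = φ.hom (w i)) ∧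
      Uniform (classDOBar H) w' ∧ (∀ i x, proj H A (x * w' i) = proj H A (act l' i x)) ∧
      (b → ∀ i, proj H A (w' i * w' i) = proj H A (w' i) →
        proj (classDOBar H) A (w' i * w' i) = proj (classDOBar H) A (w' i))

variable {H : FinSemigroupClass} {σ : ImplicitSignature} {φ : OntoHom A S}

theorem Approximable.mono {b b' : Prop} {w : I → Pseudoword A} (h : Approximable H σ φ b w)
    (hb : b' → b) : Approximable H σ φ b' w := by
  obtain ⟨l, h1, h2, h3⟩ := h
  refine ⟨l, h1, h2, fun l' hl' => ?_⟩
  obtain ⟨w', a1, a2, a3, a4, a5⟩ := h3 l' hl'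
  exact ⟨w', a1, a2, a3, a4, fun hb' => a5 (hb hb')⟩

theorem exists_append_of_forall₂ {α : Type} {R : α → α → Prop} {l₁ l₂ l' : List α}
    (h : List.Forall₂ R (l₁ ++ l₂) l') :
    ∃ l₁' l₂', l' = l₁' ++ l₂' ∧ List.Forall₂ R l₁ l₁' ∧ List.Forall₂ R l₂ l₂' :=
  ⟨_, _, (List.take_append_drop l₁.length l').symm, List.forall₂_take_append _ _ _ h.flip |>.flip,
    List.forall₂_drop_append _ _ _ h.flip |>.flip⟩

/-- The lists are concatenated. The lifting of idempotency from H is not claimed for products, hence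
the flag `False`. -/
theorem Approximable.mul {b b' : Prop} {u v : I → Pseudoword A} (hu : Approximable H σ φ b u)
    (hv : Approximable H σ φ b' v) : Approximable H σ φ False (u * v) := by
  obtain ⟨l₁, h1, h2, h3⟩ := hu
  obtain ⟨l₂, k1, k2, k3⟩ := hv
  refine ⟨l₁ ++ l₂, ?_, fun i x => ?_, fun l' hl' => ?_⟩
  · intro e he
    rcases List.mem_append.1 he with he | he
    exacts [h1 e he, k1 e he]
  · rw [Pi.mul_apply, ← mul_assoc, k2, act_append]
    exact proj_act_congr _ _ (h2 i x)
  · obtain ⟨l₁', l₂', rfl, m1, m2⟩ := exists_append_of_forall₂ hl'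
    obtain ⟨u', a1, a2, a3, a4, -⟩ := h3 l₁' m1
    obtain ⟨v', b1, b2, b3, b4, -⟩ := k3 l₂' m2
    refine ⟨u' * v', fun i => (a1 i).mul (b1 i), fun i => ?_, a3.mul b3, fun i x => ?_,
      fun h => h.elim⟩
    · rw [Pi.mul_apply, Pi.mul_apply, map_mul, map_mul, a2, b2]
    · rw [Pi.mul_apply, ← mul_assoc, b4, act_append]
      exact proj_act_congr _ _ (a4 i x)

/-- Since φ separates letters from all other pseudowords, a letter is its own only replacement.
Uniformity over H alone would not give uniformity over DO ∩ H̄. -/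
theorem approximable_letter (hφ : ∀ x a, φ.hom x = φ.hom (letter a) → x = letter a) (a : A) :
    Approximable H σ φ False fun _ : I => letter a := by
  refine ⟨[fun _ => letter a], by simp [Uniform], fun i x => rfl, fun l' hl' => ?_⟩
  obtain ⟨e', l'', he', hl'', rfl⟩ := List.forall₂_cons_left_iff.1 hl'
  rw [List.forall₂_nil_left_iff] at hl''
  subst hl''
  have : e' = fun _ => letter a := funext fun i => hφ _ _ (he'.2.1 i)
  subst this
  exact ⟨_, fun i => .letter a, fun i => rfl, fun _ _ => rfl, fun i x => rfl, fun h => h.elim⟩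

theorem Approximable.exists_family {b : Prop} {w : I → Pseudoword A}
    (hrep : ∀ e : I → Pseudoword A, Uniform H e → ∃ e', IsReplacement H σ φ e e')
    (hw : Approximable H σ φ b w) : ∃ w' : I → Pseudoword A,
      (∀ i, SigmaWord σ.addOmega A (w' i)) ∧ (∀ i, φ.hom (w' i) = φ.hom (w i)) ∧
      Uniform (classDOBar H) w' := by
  obtain ⟨l, h1, -, h3⟩ := hw
  have : ∃ l', List.Forall₂ (IsReplacement H σ φ) l l' := by
    clear h3
    induction l with
    | nil => exact ⟨[], .nil⟩
    | cons e l ih =>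
      obtain ⟨l', hl'⟩ := ih fun e he => h1 e (List.mem_cons_of_mem _ he)
      obtain ⟨e', he'⟩ := hrep e (h1 e List.mem_cons_self)
      exact ⟨e' :: l', .cons he' hl'⟩
  obtain ⟨l', hl'⟩ := this
  obtain ⟨w', a1, a2, a3, -⟩ := h3 l' hl'
  exact ⟨w', a1, a2, a3⟩

variable [Finite A] [Nonempty A] [Finite S]

/-- The approximant is p' m'^ω s' n'^ω q'. Under φ the ω-powers are absorbed by p' and q'. As φ
determines contents, replacements keep the contents required between the ω-powers. -/
theorem approximable_of_regular (hH : H.IsGroupPseudovariety)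
    (hφ : ∀ x y, φ.hom x = φ.hom y →
      content (x : WithOne (Pseudoword A)) = content (y : WithOne (Pseudoword A)))
    (hrep : ∀ e : I → Pseudoword A, Uniform H e → ∃ e', IsReplacement H σ φ e e')
    -- The families m and n enter only through ω-powers, which are trivial over H. Their
    -- replacements can thus be fixed beforehand and do not contribute to the list.
    {p m s n q : I → Pseudoword A} {B : Set A}
    (hp : Approximable H σ φ False p) (hm : Approximable H σ φ False m)
    (hn : Approximable H σ φ False n) (hq : Approximable H σ φ False q)
    (hs : Uniform H s) (hpB : ∀ i, content (p i : WithOne (Pseudoword A)) ⊆ B)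
    (hmB : ∀ i, content (m i : WithOne (Pseudoword A)) = B)
    (hsB : ∀ i, content (s i : WithOne (Pseudoword A)) = B)
    (hnB : ∀ i, content (n i : WithOne (Pseudoword A)) = B)
    (hqB : ∀ i, content (q i : WithOne (Pseudoword A)) ⊆ B)
    (hpm : ∀ i, φ.hom (p i) * φ.hom (m i) = φ.hom (p i))
    (hnq : ∀ i, φ.hom (n i) * φ.hom (q i) = φ.hom (q i)) :
    Approximable H σ φ True (p * (s * q)) := by
  obtain ⟨m', m1, m2, m3⟩ := hm.exists_family hrep
  obtain ⟨n', n1, n2, n3⟩ := hn.exists_family hrep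
  obtain ⟨lp, p1, p2, p3⟩ := hp
  obtain ⟨lq, q1, q2, q3⟩ := hq
  refine ⟨lp ++ ([s] ++ lq), ?_, fun i x => ?_, fun l' hl' => ?_⟩
  · intro e he
    simp only [List.mem_append, List.mem_singleton] at he
    rcases he with he | rfl | he
    exacts [p1 e he, hs, q1 e he]
  · simp only [Pi.mul_apply, ← mul_assoc, act_append, q2, act_cons, act_nil]
    refine proj_act_congr _ _ ?_
    rw [map_mul, map_mul _ (act lp i x), p2]
  · obtain ⟨lp', l'', rfl, hlp, hl''⟩ := exists_append_of_forall₂ hl'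
    obtain ⟨ls, lq', rfl, hls, hlq⟩ := exists_append_of_forall₂ hl''
    obtain ⟨s', l₀, ⟨s1, s2, s3⟩, hl₀, rfl⟩ := List.forall₂_cons_left_iff.1 hls
    rw [List.forall₂_nil_left_iff] at hl₀
    subst hl₀
    obtain ⟨p', a1, a2, a3, a4, -⟩ := p3 lp' hlp
    obtain ⟨q', b1, b2, b3, b4, -⟩ := q3 lq' hlq
    have cm : ∀ i, content (m' i : WithOne (Pseudoword A)) = B := fun i =>
      (hφ _ _ (m2 i)).trans (hmB i)
    have cn : ∀ i, content (n' i : WithOne (Pseudoword A)) = B := fun i =>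
      (hφ _ _ (n2 i)).trans (hnB i)
    have cs : ∀ i, content (s' i : WithOne (Pseudoword A)) = B := fun i =>
      (hφ _ _ (s2 i)).trans (hsB i)
    have cp : ∀ i, content (p' i : WithOne (Pseudoword A)) ⊆ B := fun i =>
      (hφ _ _ (a2 i)).le.trans (hpB i)
    have cq : ∀ i, content (q' i : WithOne (Pseudoword A)) ⊆ B := fun i =>
      (hφ _ _ (b2 i)).le.trans (hqB i)
    refine ⟨fun i => p' i * (omega (m' i) * s' i * omega (n' i)) * q' i, fun i => ?_, fun i => ?_,
      fun i j => ?_, fun i x => ?_, fun _ i hi => ?_⟩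
    · exact ((a1 i).mul (((m1 i).omega.mul (s1 i).addOmega).mul (n1 i).omega)).mul (b1 i)
    · have h1 : φ.hom (p' i) * φ.hom (omega (m' i)) = φ.hom (p' i) :=
        mul_of_mem_closure (by rw [a2, m2, hpm]) (φ.map_omega (m' i))
      have h2 : φ.hom (omega (n' i)) * φ.hom (q' i) = φ.hom (q' i) :=
        mul_of_mem_closure_left (by rw [b2, n2, hnq]) (φ.map_omega (n' i))
      simp only [map_mul, Pi.mul_apply]
      rw [mul_assoc, mul_assoc _ (φ.hom (omega (n' i))), h2, ← mul_assoc, ← mul_assoc, h1, a2, s2,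
        b2, mul_assoc]
    · have h1 := omega_mul_mul_omega_eq hH ((cm i).trans (cn i).symm) ((cs i).trans (cm i).symm).le
        ((cs j).trans (cm i).symm).le (s3 i j)
      simp only [map_mul] at h1 ⊢
      rw [h1, a3 i j, b3 i j, proj_omega_congr hH (m3 i j), proj_omega_congr hH (n3 i j)]
    · have h1 : proj H A (x * (p' i * (omega (m' i) * s' i * omega (n' i)) * q' i)) =
          proj H A ((x * p' i) * s' i * q' i) := by
        simp only [map_mul, mul_assoc, proj_omega_mul hH]
      rw [h1, b4, act_append, act_append, act_cons, act_nil]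
      refine proj_act_congr _ _ ?_
      rw [map_mul, a4, map_mul]
    -- Cancelling p' and q' in the idempotency over H leaves an identity between words of content B.
    -- Enclosed between m'^ω and n'^ω, it holds over DO ∩ H̄.
    · have h1 : proj H A (s' i * omega (n' i) * q' i * p' i * omega (m' i) * s' i) =
          proj H A (s' i) := by
        refine proj_right_cancel hH (x := q' i) (proj_left_cancel hH (x := p' i) ?_)
        simp only [map_mul, mul_assoc, proj_omega_mul hH] at hi ⊢
        exact hi
      have h2 := omega_mul_mul_omega_eq hH ((cm i).trans (cn i).symm)
        (s := s' i * omega (n' i) * q' i * p' i * omega (m' i) * s' i) (z := s' i)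
        (by simp [cs, cn, cm, cp, cq]) ((cs i).trans (cm i).symm).le h1
      calc proj (classDOBar H) A (p' i * (omega (m' i) * s' i * omega (n' i)) * q' i *
            (p' i * (omega (m' i) * s' i * omega (n' i)) * q' i))
          = proj (classDOBar H) A (p' i) * proj (classDOBar H) A (omega (m' i) *
            (s' i * omega (n' i) * q' i * p' i * omega (m' i) * s' i) * omega (n' i)) *
              proj (classDOBar H) A (q' i) := by
            simp only [← map_mul, mul_assoc]
        _ = _ := by rw [h2, ← map_mul, ← map_mul]

end Families

/-! ### Peeling one block off a family. -/

section Steps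

variable {A I S : Type} [Semigroup S]
  {H : FinSemigroupClass} {σ : ImplicitSignature} {φ : OntoHom A S}

/-- Over `DO ∩ H̄` the possibly empty pseudoword `z` lies in the ideal generated by `w`. -/
def InIdeal (H : FinSemigroupClass) (w : Pseudoword A) (z : WithOne (Pseudoword A)) : Prop :=
  ∃ x y : WithOne (Pseudoword A),
    MonoidEq (classDOBar H) z (x * (w : WithOne (Pseudoword A)) * y)

/-- The approximable uniform families of content `B`. -/
def blocks (H : FinSemigroupClass) (σ : ImplicitSignature) (φ : OntoHom A S) (i₀ : I)
    (B : Set A) : Set (I → Pseudoword A) :=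
  {b | Uniform (classDOBar H) b ∧ content (b i₀ : WithOne (Pseudoword A)) = B ∧
    Approximable H σ φ False b}

/-- The uniform families of content `B` that are not approximable or that lie, over `DO ∩ H̄`,
in the ideal generated by `w`. -/
def remainders (H : FinSemigroupClass) (σ : ImplicitSignature) (φ : OntoHom A S) (i₀ : I)
    (B : Set A) (w : Pseudoword A) : Set (I → Pseudoword A) :=
  {r | Uniform (classDOBar H) r ∧ content (r i₀ : WithOne (Pseudoword A)) = B ∧
    (¬ Approximable H σ φ False r ∨ InIdeal H w (r i₀))}

theorem blocks_mul {i₀ : I} {B : Set A} {b c : I → Pseudoword A} (hb : b ∈ blocks H σ φ i₀ B)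
    (hc : c ∈ blocks H σ φ i₀ B) : b * c ∈ blocks H σ φ i₀ B :=
  ⟨hb.1.mul hc.1, by simp [hb.2.1, hc.2.1], hb.2.2.mul hc.2.2⟩

theorem monoidEq_mul_idem {V : FinSemigroupClass} {w : Pseudoword A}
    (hw : MonoidEq V (w * w : WithOne (Pseudoword A)) w) {x y z : WithOne (Pseudoword A)}
    (h : MonoidEq V z (x * (w : WithOne (Pseudoword A)) * y)) :
    MonoidEq V z ((x * (w : WithOne (Pseudoword A))) * ((w : WithOne (Pseudoword A)) * y)) := by
  have := h.trans (((MonoidEq.refl x).mul hw.symm).mul (MonoidEq.refl y))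
  simpa only [mul_assoc] using this

/-- Both alternatives exclude content smaller than B: such a family is approximable by induction,
while the ideal of w₀ contains only pseudowords using every letter of B. -/
theorem remainders_of_mul_left {i₀ : I} {B : Set A} {w₀ : Pseudoword A}
    (hw₀B : content (w₀ : WithOne (Pseudoword A)) = B)
    (hIH : ∀ u : I → Pseudoword A, Uniform (classDOBar H) u →
      content (u i₀ : WithOne (Pseudoword A)) ⊂ B → Approximable H σ φ False u)
    {r : I → Pseudoword A} (hr : Uniform (classDOBar H) r)
    (hrB : content (r i₀ : WithOne (Pseudoword A)) ⊆ B) (hH : H.IsGroupPseudovariety)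
    (h : ¬ Approximable H σ φ False r ∨ InIdeal H w₀ (r i₀)) :
    r ∈ remainders H σ φ i₀ B w₀ := by
  refine ⟨hr, hrB.eq_or_ssubset.resolve_right fun hlt => ?_, h⟩
  rcases h with h | ⟨x, y, h⟩
  · exact h (hIH r hr hlt)
  · refine hlt.2 ?_
    rw [h.content_eq hH, ← hw₀B]
    intro b hb
    simp [hb]

variable [Finite A] [Nonempty A]

/-- Equality over DO ∩ H̄ preserves content, so the factors are all empty or all nonempty. -/
theorem exists_family_of_monoidEq (hH : H.IsGroupPseudovariety) [Nonempty I]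
    {u : I → WithOne (Pseudoword A)} (h : ∀ i j, MonoidEq (classDOBar H) (u i) (u j)) :
    (∀ i, u i = 1) ∨ ∃ u' : I → Pseudoword A, (∀ i, u i = u' i) ∧ Uniform (classDOBar H) u' := by
  by_cases h1 : ∃ i, u i = 1
  · obtain ⟨i, hi⟩ := h1
    exact Or.inl fun j => eq_one_of_content_eq_empty (by
      rw [(h j i).content_eq hH, hi, content_one])
  · push Not at h1
    have hu : ∀ i, u i = (WithOne.unone (h1 i) : Pseudoword A) := fun i =>
      (WithOne.coe_unone (h1 i)).symm
    refine Or.inr ⟨fun i => WithOne.unone (h1 i), hu, fun i j => ?_⟩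
    rw [← monoidEq_coe_iff hH, ← hu, ← hu]
    exact h i j

/-- The block is u a, from the left basic factorization u a v. If nonempty, u is approximable by
induction since it misses a. The remainder v inherits whichever alternative w satisfies. -/
theorem remainders_left_step (hH : H.IsGroupPseudovariety) [Nonempty I]
    (hφ : ∀ x a, φ.hom x = φ.hom (letter a) → x = letter a) {i₀ : I} {B : Set A}
    {w₀ : Pseudoword A}
    (hw₀ : MonoidEq (classDOBar H) (w₀ * w₀ : WithOne (Pseudoword A)) w₀)
    (hw₀B : content (w₀ : WithOne (Pseudoword A)) = B)
    (hIH : ∀ u : I → Pseudoword A, Uniform (classDOBar H) u →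
      content (u i₀ : WithOne (Pseudoword A)) ⊂ B → Approximable H σ φ False u)
    {w : I → Pseudoword A} (hw : w ∈ remainders H σ φ i₀ B w₀) :
    ∃ b ∈ blocks H σ φ i₀ B, ∃ r ∈ remainders H σ φ i₀ B w₀, w = b * r := by
  obtain ⟨hw1, hwB, hw2⟩ := hw
  obtain ⟨u₀, a, v₀, h0, hu₀, hc⟩ := exists_left_basic (w i₀)
  rw [hwB] at hc
  have haB : a ∈ B := by simp [hc]
  have hex := fun i => exists_first_occurrence (w i) (a := a)
    (by rw [hw1.content_eq hH i i₀, hwB]; exact haB)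
  choose u v huv hau using hex
  have huniq : ∀ i j, MonoidEq (classDOBar H) (u i) (u j) ∧
      MonoidEq (classDOBar H) (v i) (v j) := fun i j =>
    first_occurrence_unique hH (by rw [← huv i, ← huv j]; exact (monoidEq_coe_iff hH).2 (hw1 i j))
      (hau i) (hau j)
  have hu₀' : content (u i₀) = content u₀ :=
    (first_occurrence_unique hH (by rw [← huv i₀, ← h0]; exact MonoidEq.refl _)
      (hau i₀) hu₀).1.content_eq hH
  obtain ⟨b, hb, hbu⟩ : ∃ b ∈ blocks H σ φ i₀ B,
      ∀ i, (b i : WithOne (Pseudoword A)) = u i * (letter a : WithOne (Pseudoword A)) := by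
    have hbB : ∀ b : I → Pseudoword A,
        (∀ i, (b i : WithOne (Pseudoword A)) = u i * (letter a : WithOne (Pseudoword A))) →
        content (b i₀ : WithOne (Pseudoword A)) = B := fun b hb => by
      rw [hb, content_mul, content_letter, hu₀', hc, Set.union_singleton]
    rcases exists_family_of_monoidEq hH fun i j => (huniq i j).1 with h1 | ⟨u', h1, h2⟩
    · have h3 : ∀ i : I, ((letter a : Pseudoword A) : WithOne (Pseudoword A)) =
        u i * (letter a : WithOne (Pseudoword A)) := fun i => by rw [h1, one_mul]
      exact ⟨fun _ => letter a, ⟨fun _ _ => rfl, hbB _ h3, approximable_letter hφ a⟩, h3⟩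
    · have h3 : ∀ i : I, ((u' i * letter a : Pseudoword A) : WithOne (Pseudoword A)) =
        u i * (letter a : WithOne (Pseudoword A)) := fun i => by rw [h1, WithOne.coe_mul]
      refine ⟨u' * fun _ => letter a, ⟨h2.mul fun _ _ => rfl, hbB _ h3,
        (hIH u' h2 ?_).mul (approximable_letter hφ a)⟩, h3⟩
      rw [← h1, hu₀', hc]
      exact Set.ssubset_insert hu₀
  -- Idempotency of w₀ gives (x w₀)(w₀ y). The first a occurs in x w₀, so a copy of w₀ remains after
  -- it.
  have hideal : InIdeal H w₀ (w i₀) → InIdeal H w₀ (v i₀) := by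
    rintro ⟨x, y, h⟩
    obtain ⟨t, ht⟩ := exists_coe_eq_mul_mul x 1 w₀
    rw [mul_one] at ht
    obtain ⟨u', v', h1, h2⟩ := exists_first_occurrence t (a := a) (by simp [ht, hw₀B, haB])
    have h3 := monoidEq_mul_idem hw₀ h
    rw [← ht, h1, huv i₀, mul_assoc _ v'] at h3
    exact ⟨v', y, by simpa only [mul_assoc] using (first_occurrence_unique hH h3 (hau i₀) h2).2⟩
  refine ⟨b, hb, ?_⟩
  rcases exists_family_of_monoidEq hH fun i j => (huniq i j).2 with h1 | ⟨r, h1, h2⟩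
  -- An empty remainder would make w an approximable block or put the empty word in the ideal of w₀.
  · exfalso
    rcases hw2 with h | h
    · have : w = b := funext fun i => WithOne.coe_injective (by rw [hbu, huv, h1, mul_one])
      exact h (this ▸ hb.2.2)
    · obtain ⟨x, y, h⟩ := hideal h
      have := h.content_eq hH
      rw [h1, content_one] at this
      exact Set.notMem_empty a (this ▸ by simp [hw₀B, haB])
  · have hwr : w = b * r := funext fun i => WithOne.coe_injective (by
      rw [Pi.mul_apply, WithOne.coe_mul, hbu, huv, h1])
    refine ⟨r, remainders_of_mul_left hw₀B hIH h2 ?_ hH ?_, hwr⟩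
    · rw [← hwB, hwr]
      intro b hb
      simp [hb]
    · rcases hw2 with h | h
      · exact Or.inl fun hr => h (hwr ▸ hb.2.2.mul hr)
      · exact Or.inr (h1 i₀ ▸ hideal h)

theorem remainders_right_step (hH : H.IsGroupPseudovariety) [Nonempty I]
    (hφ : ∀ x a, φ.hom x = φ.hom (letter a) → x = letter a) {i₀ : I} {B : Set A}
    {w₀ : Pseudoword A}
    (hw₀ : MonoidEq (classDOBar H) (w₀ * w₀ : WithOne (Pseudoword A)) w₀)
    (hw₀B : content (w₀ : WithOne (Pseudoword A)) = B)
    (hIH : ∀ u : I → Pseudoword A, Uniform (classDOBar H) u →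
      content (u i₀ : WithOne (Pseudoword A)) ⊂ B → Approximable H σ φ False u)
    {w : I → Pseudoword A} (hw : w ∈ remainders H σ φ i₀ B w₀) :
    ∃ b ∈ blocks H σ φ i₀ B, ∃ r ∈ remainders H σ φ i₀ B w₀, w = r * b := by
  obtain ⟨hw1, hwB, hw2⟩ := hw
  obtain ⟨v₀, a, u₀, h0, hu₀, hc⟩ := exists_right_basic (w i₀)
  rw [hwB] at hc
  have haB : a ∈ B := by simp [hc]
  have hex := fun i => exists_last_occurrence (w i) (a := a)
    (by rw [hw1.content_eq hH i i₀, hwB]; exact haB)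
  choose v u huv hau using hex
  have huniq : ∀ i j, MonoidEq (classDOBar H) (v i) (v j) ∧
      MonoidEq (classDOBar H) (u i) (u j) := fun i j =>
    last_occurrence_unique hH (by rw [← huv i, ← huv j]; exact (monoidEq_coe_iff hH).2 (hw1 i j))
      (hau i) (hau j)
  have hu₀' : content (u i₀) = content u₀ :=
    (last_occurrence_unique hH (by rw [← huv i₀, ← h0]; exact MonoidEq.refl _)
      (hau i₀) hu₀).2.content_eq hH
  obtain ⟨b, hb, hbu⟩ : ∃ b ∈ blocks H σ φ i₀ B,
      ∀ i, (b i : WithOne (Pseudoword A)) = (letter a : WithOne (Pseudoword A)) * u i := by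
    have hbB : ∀ b : I → Pseudoword A,
        (∀ i, (b i : WithOne (Pseudoword A)) = (letter a : WithOne (Pseudoword A)) * u i) →
        content (b i₀ : WithOne (Pseudoword A)) = B := fun b hb => by
      rw [hb, content_mul, content_letter, hu₀', hc, Set.singleton_union]
    rcases exists_family_of_monoidEq hH fun i j => (huniq i j).2 with h1 | ⟨u', h1, h2⟩
    · have h3 : ∀ i : I, ((letter a : Pseudoword A) : WithOne (Pseudoword A)) =
        (letter a : WithOne (Pseudoword A)) * u i := fun i => by rw [h1, mul_one]
      exact ⟨fun _ => letter a, ⟨fun _ _ => rfl, hbB _ h3, approximable_letter hφ a⟩, h3⟩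
    · have h3 : ∀ i : I, ((letter a * u' i : Pseudoword A) : WithOne (Pseudoword A)) =
        (letter a : WithOne (Pseudoword A)) * u i := fun i => by rw [h1, WithOne.coe_mul]
      have hl : Uniform (classDOBar H) fun _ : I => (letter a : Pseudoword A) := fun _ _ => rfl
      refine ⟨(fun _ => letter a) * u', ⟨hl.mul h2, hbB _ h3,
        (approximable_letter hφ a).mul (hIH u' h2 ?_)⟩, h3⟩
      rw [← h1, hu₀', hc]
      exact Set.ssubset_insert hu₀
  have hideal : InIdeal H w₀ (w i₀) → InIdeal H w₀ (v i₀) := by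
    rintro ⟨x, y, h⟩
    obtain ⟨t, ht⟩ := exists_coe_eq_mul_mul 1 y w₀
    rw [one_mul] at ht
    obtain ⟨v', u', h1, h2⟩ := exists_last_occurrence t (a := a) (by simp [ht, hw₀B, haB])
    have h3 := monoidEq_mul_idem hw₀ h
    rw [← ht, h1, huv i₀, ← mul_assoc _ _ u', ← mul_assoc _ v'] at h3
    exact ⟨x, v', (last_occurrence_unique hH h3 (hau i₀) h2).1⟩
  refine ⟨b, hb, ?_⟩
  rcases exists_family_of_monoidEq hH fun i j => (huniq i j).1 with h1 | ⟨r, h1, h2⟩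
  · exfalso
    rcases hw2 with h | h
    · have : w = b := funext fun i => WithOne.coe_injective (by rw [hbu, huv, h1, one_mul])
      exact h (this ▸ hb.2.2)
    · obtain ⟨x, y, h⟩ := hideal h
      have := h.content_eq hH
      rw [h1, content_one] at this
      exact Set.notMem_empty a (this ▸ by simp [hw₀B, haB])
  · have hwr : w = r * b := funext fun i => WithOne.coe_injective (by
      rw [Pi.mul_apply, WithOne.coe_mul, hbu, huv, h1, mul_assoc])
    refine ⟨r, remainders_of_mul_left hw₀B hIH h2 ?_ hH ?_, hwr⟩
    · rw [← hwB, hwr]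
      intro b hb
      simp [hb]
    · rcases hw2 with h | h
      · exact Or.inl fun hr => h (hwr ▸ hr.mul hb.2.2)
      · exact Or.inr (h1 i₀ ▸ hideal h)

end Steps

/-! ### Repetition of values along an infinite peeling. -/

section Pigeonhole

variable {P F : Type} [Semigroup P] [Semigroup F] [Finite F]

/-- Peeling for ever produces prefixes, each obtained from the previous one by multiplication with
an element of G. Two of them have the same value under Q, and m is the factor that leads from one to
the other. -/
theorem exists_stable_prefix (Q : P →ₙ* F) (G W : Set P)
    (hG : ∀ x ∈ G, ∀ y ∈ G, x * y ∈ G) (hstep : ∀ w ∈ W, ∃ b ∈ G, ∃ r ∈ W, w = b * r) {w : P}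
    (hw : w ∈ W) : ∃ p ∈ G, ∃ m ∈ G, ∃ r ∈ W, w = p * r ∧ Q p * Q m = Q p := by
  choose! β hβ ρ hρ h using hstep
  have hR : ∀ n, ρ^[n] w ∈ W := fun n => by
    induction n with
    | zero => exact hw
    | succ n ih => rw [Function.iterate_succ_apply']; exact hρ _ ih
  let p : ℕ → P := fun n => Nat.rec (β w) (fun n x => x * β (ρ^[n + 1] w)) n
  have hp : ∀ n, p (n + 1) = p n * β (ρ^[n + 1] w) := fun n => rfl
  have hpG : ∀ n, p n ∈ G ∧ w = p n * ρ^[n + 1] w := fun n => by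
    induction n with
    | zero => exact ⟨hβ w hw, h w hw⟩
    | succ n ih =>
      refine ⟨hG _ ih.1 _ (hβ _ (hR _)), ?_⟩
      rw [hp, mul_assoc, Function.iterate_succ_apply' ρ (n + 1), ← h _ (hR _)]
      exact ih.2
  have hlt : ∀ k l, k < l → ∃ m ∈ G, p l = p k * m := by
    intro k l hkl
    induction l, hkl using Nat.le_induction with
    | base => exact ⟨_, hβ _ (hR _), hp k⟩
    | succ l _ ih =>
      obtain ⟨m, hm, h'⟩ := ih
      exact ⟨_, hG _ hm _ (hβ _ (hR (l + 1))), by rw [hp, h', mul_assoc]⟩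
  obtain ⟨k, l, hkl, hQ⟩ := Finite.exists_ne_map_eq_of_infinite fun n => Q (p n)
  wlog hlt' : k < l generalizing k l
  · exact this l k hkl.symm hQ.symm (by omega)
  obtain ⟨m, hm, h'⟩ := hlt k l hlt'
  refine ⟨p k, (hpG k).1, m, hm, _, hR (k + 1), (hpG k).2, ?_⟩
  rw [← map_mul, ← h']
  exact hQ.symm

theorem exists_stable_suffix (Q : P →ₙ* F) (G W : Set P)
    (hG : ∀ x ∈ G, ∀ y ∈ G, x * y ∈ G) (hstep : ∀ w ∈ W, ∃ b ∈ G, ∃ r ∈ W, w = r * b) {w : P}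
    (hw : w ∈ W) : ∃ p ∈ G, ∃ m ∈ G, ∃ r ∈ W, w = r * p ∧ Q m * Q p = Q p := by
  have : Finite Fᵐᵒᵖ := Finite.of_equiv F MulOpposite.opEquiv
  obtain ⟨p, hp, m, hm, r, hr, h1, h2⟩ := exists_stable_prefix (MulHom.op Q)
    (MulOpposite.unop ⁻¹' G) (MulOpposite.unop ⁻¹' W) (fun x hx y hy => hG _ hy _ hx)
    (fun w hw => by
      obtain ⟨b, hb, r, hr, h⟩ := hstep _ hw
      exact ⟨.op b, hb, .op r, hr, MulOpposite.unop_injective h⟩) (w := .op w) hw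
  exact ⟨p.unop, hp, m.unop, hm, r.unop, hr, congrArg MulOpposite.unop h1,
    congrArg MulOpposite.unop h2⟩

end Pigeonhole

/-! ### Approximability of uniform and of idempotent families. -/

section Main

variable {A I S : Type} [Semigroup S] [Finite S] [Finite A] [Nonempty A] [Finite I]
  {H : FinSemigroupClass} {σ : ImplicitSignature} {φ : OntoHom A S}

/-- Peel on the left to get p r, then peel r on the right to get p s q. The middle s is still a
remainder, so it has full content B. -/
theorem approximable_of_mem_remainders (hH : H.IsGroupPseudovariety)
    (hφc : ∀ x y, φ.hom x = φ.hom y →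
      content (x : WithOne (Pseudoword A)) = content (y : WithOne (Pseudoword A)))
    (hφ : ∀ x a, φ.hom x = φ.hom (letter a) → x = letter a)
    (hrep : ∀ e : I → Pseudoword A, Uniform H e → ∃ e', IsReplacement H σ φ e e')
    {i₀ : I} {B : Set A} {w₀ : Pseudoword A}
    (hw₀ : MonoidEq (classDOBar H) (w₀ * w₀ : WithOne (Pseudoword A)) w₀)
    (hw₀B : content (w₀ : WithOne (Pseudoword A)) = B)
    (hIH : ∀ u : I → Pseudoword A, Uniform (classDOBar H) u →
      content (u i₀ : WithOne (Pseudoword A)) ⊂ B → Approximable H σ φ False u)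
    {w : I → Pseudoword A} (hw : w ∈ remainders H σ φ i₀ B w₀) :
    Approximable H σ φ True w := by
  have : Nonempty I := ⟨i₀⟩
  let Q : (I → Pseudoword A) →ₙ* (I → S) :=
    ⟨fun w i => φ.hom (w i), fun u v => funext fun i => map_mul φ.hom _ _⟩
  obtain ⟨p, hp, m, hm, r, hr, rfl, h1⟩ := exists_stable_prefix Q (blocks H σ φ i₀ B)
    (remainders H σ φ i₀ B w₀) (fun _ hx _ hy => blocks_mul hx hy)
    (fun _ => remainders_left_step hH hφ hw₀ hw₀B hIH) hw
  obtain ⟨q, hq, n, hn, s, hs, rfl, h2⟩ := exists_stable_suffix Q (blocks H σ φ i₀ B)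
    (remainders H σ φ i₀ B w₀) (fun _ hx _ hy => blocks_mul hx hy)
    (fun _ => remainders_right_step hH hφ hw₀ hw₀B hIH) hr
  have hc : ∀ b : I → Pseudoword A, Uniform (classDOBar H) b →
      content (b i₀ : WithOne (Pseudoword A)) = B →
      ∀ i, content (b i : WithOne (Pseudoword A)) = B :=
    fun b hb hbB i => (hb.content_eq hH i i₀).trans hbB
  exact approximable_of_regular hH hφc hrep hp.2.2 hm.2.2 hn.2.2 hq.2.2 (hs.1.group hH)
    (fun i => (hc p hp.1 hp.2.1 i).le) (hc m hm.1 hm.2.1) (hc s hs.1 hs.2.1) (hc n hn.1 hn.2.1)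
    (fun i => (hc q hq.1 hq.2.1 i).le) (congrFun h1) (congrFun h2)

theorem approximable_of_uniform (hH : H.IsGroupPseudovariety)
    (hφc : ∀ x y, φ.hom x = φ.hom y →
      content (x : WithOne (Pseudoword A)) = content (y : WithOne (Pseudoword A)))
    (hφ : ∀ x a, φ.hom x = φ.hom (letter a) → x = letter a)
    (hrep : ∀ e : I → Pseudoword A, Uniform H e → ∃ e', IsReplacement H σ φ e e')
    (i₀ : I) {w : I → Pseudoword A} (hw : Uniform (classDOBar H) w) :
    Approximable H σ φ False w := by
  induction hB : content (w i₀ : WithOne (Pseudoword A)) using WellFoundedLT.induction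
    generalizing w with
  | ind B ih =>
    by_contra hna
    -- Here w is a remainder because it is not approximable; `omega (w i₀)` merely supplies an
    -- idempotent of content B.
    refine hna ((approximable_of_mem_remainders hH hφc hφ hrep (w₀ := omega (w i₀)) (i₀ := i₀)
      (B := B) ?_ ?_ (fun u hu hlt => ih _ hlt hu rfl) ⟨hw, hB, Or.inl hna⟩).mono False.elim)
    · rw [← WithOne.coe_mul, (isIdempotentElem_omega _).eq]
      exact MonoidEq.refl _
    · rw [content_omega, hB]

/-- The member `w i₀` is itself the idempotent w₀, and it lies in its own ideal. The decomposition
thus exists without assuming non-approximability, and the flag `True` is obtained. -/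
theorem approximable_of_idempotent (hH : H.IsGroupPseudovariety)
    (hφc : ∀ x y, φ.hom x = φ.hom y →
      content (x : WithOne (Pseudoword A)) = content (y : WithOne (Pseudoword A)))
    (hφ : ∀ x a, φ.hom x = φ.hom (letter a) → x = letter a)
    (hrep : ∀ e : I → Pseudoword A, Uniform H e → ∃ e', IsReplacement H σ φ e e')
    (i₀ : I) {w : I → Pseudoword A} (hw : Uniform (classDOBar H) w)
    (hidem : proj (classDOBar H) A (w i₀ * w i₀) = proj (classDOBar H) A (w i₀)) :
    Approximable H σ φ True w := by
  refine approximable_of_mem_remainders hH hφc hφ hrep (w₀ := w i₀) (i₀ := i₀) ?_ rfl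
    (fun u hu _ => approximable_of_uniform hH hφc hφ hrep i₀ hu) ⟨hw, rfl, Or.inr ⟨1, 1, ?_⟩⟩
  · rw [← WithOne.coe_mul]
    exact (monoidEq_coe_iff hH).2 hidem
  · rw [one_mul, mul_one]
    exact MonoidEq.refl _

end Main

/-! ### Graph systems that produce replacements. -/

section Graph

variable {A I S : Type} [Semigroup S] [Finite S] [Finite A] [Nonempty A] [Finite I]
  {H : FinSemigroupClass} {σ : ImplicitSignature}

/-- The members of the family label parallel edges between two vertices, and cancellation over H
makes the labels of any solution uniform. -/
theorem GraphReducible.exists_replacement (hσ : GraphReducible H σ) (hH : H.IsGroupPseudovariety)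
    (φ : OntoHom A S) (i₀ : I) {e : I → Pseudoword A} (he : Uniform H e) :
    ∃ e', IsReplacement H σ φ e e' := by
  let γ : Bool ⊕ I → Pseudoword A := Sum.elim (fun b => if b then e i₀ * e i₀ else e i₀) e
  obtain ⟨γ', h1, h2, h3⟩ := hσ ⟨Bool, I, fun _ => false, fun _ => true⟩ S A φ
    (fun x => φ.hom (γ x)) ⟨γ, fun _ => rfl, fun i => by
      change proj H A (e i₀ * e i) = proj H A (e i₀ * e i₀)
      rw [map_mul, map_mul, he i i₀]⟩
  exact ⟨fun i => γ' (.inr i), fun i => h1 _, fun i => h2 _, fun i j =>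
    proj_left_cancel hH ((h3 i).trans (h3 j).symm)⟩

/-- The graph is a cycle with one step per member of the list and |I| parallel edges at each step.
Cancellation over H gives uniformity of each replacement; following the edges of index i₀ round the
cycle gives the fixed point. -/
theorem GraphReducible.exists_closed_replacement (hσ : GraphReducible H σ)
    (hH : H.IsGroupPseudovariety) (φ : OntoHom A S) (i₀ : I) {l : List (I → Pseudoword A)}
    (hl : ∀ e ∈ l, Uniform H e) {x : Pseudoword A} (hx : proj H A (act l i₀ x) = proj H A x) :
    ∃ l', List.Forall₂ (IsReplacement H σ φ) l l' ∧
      ∃ x, proj H A (act l' i₀ x) = proj H A x := by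
  -- The last step returns to vertex 0. For a nonempty list the vertex `l.length` is isolated; the
  -- extra vertex ensures that vertex 0 exists for the empty list.
  let nxt : Fin l.length → Fin (l.length + 1) := fun t =>
    if t.1 + 1 = l.length then 0 else t.succ
  let γ : Fin (l.length + 1) ⊕ Fin l.length × I → Pseudoword A :=
    Sum.elim (fun t => act (l.take t) i₀ x) fun t => l[t.1] t.2
  have hγ : ∀ t : Fin l.length,
      proj H A (γ (.inl (nxt t))) = proj H A (act (l.take (t.1 + 1)) i₀ x) := by
    intro t
    by_cases ht : t.1 + 1 = l.length
    · simp only [nxt, ht, if_true, γ, Sum.elim_inl, List.take_length]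
      exact hx.symm
    · simp [nxt, ht, γ]
  obtain ⟨γ', h1, h2, h3⟩ := hσ ⟨Fin (l.length + 1), Fin l.length × I, fun t => t.1.castSucc,
    fun t => nxt t.1⟩ S A φ (fun x => φ.hom (γ x)) ⟨γ, fun _ => rfl, fun t => by
      refine Eq.trans ?_ (hγ t.1).symm
      rw [List.take_succ_eq_append_getElem t.1.2, act_append, act_cons, act_nil, map_mul, map_mul]
      exact congrArg _ (hl _ (List.getElem_mem _) t.2 i₀)⟩
  have h3 : ∀ t : Fin l.length × I, proj H A (γ' (.inl t.1.castSucc) * γ' (.inr t)) =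
    proj H A (γ' (.inl (nxt t.1))) := h3
  let l' : List (I → Pseudoword A) := List.ofFn fun t : Fin l.length => fun i => γ' (.inr (t, i))
  have hl' : l'.length = l.length := List.length_ofFn
  refine ⟨l', ?_, γ' (.inl 0), ?_⟩
  · rw [List.forall₂_iff_get]
    refine ⟨hl'.symm, fun t ht ht' => ?_⟩
    have : l'.get ⟨t, ht'⟩ = fun i => γ' (.inr (⟨t, ht⟩, i)) := by simp [l']
    rw [this]
    exact ⟨fun i => h1 _, fun i => h2 _, fun i j =>
      proj_left_cancel hH ((h3 (⟨t, ht⟩, i)).trans (h3 (⟨t, ht⟩, j)).symm)⟩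
  · have key : ∀ t (ht : t < l.length), proj H A (act (l'.take (t + 1)) i₀ (γ' (.inl 0))) =
        proj H A (γ' (.inl (nxt ⟨t, ht⟩))) := by
      intro t ht
      have hstep : ∀ t (ht : t < l.length), proj H A (act (l'.take t) i₀ (γ' (.inl 0))) =
          proj H A (γ' (.inl (Fin.castSucc ⟨t, ht⟩))) →
          proj H A (act (l'.take (t + 1)) i₀ (γ' (.inl 0))) =
            proj H A (γ' (.inl (nxt ⟨t, ht⟩))) := by
        intro t ht h
        rw [List.take_succ_eq_append_getElem (hl'.symm ▸ ht), act_append, act_cons, act_nil,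
          map_mul, h, ← h3 (⟨t, ht⟩, i₀), map_mul]
        simp [l']
      induction t with
      | zero => exact hstep 0 ht rfl
      | succ t ih =>
        refine hstep _ ht ((ih (by omega)).trans ?_)
        have : t + 1 ≠ l.length := by omega
        simp only [nxt, this, if_false]
        rfl
    rcases Nat.eq_zero_or_pos l.length with h0 | h0
    · rw [List.length_eq_zero_iff.1 (hl'.trans h0), act_nil]
    · have h4 := key (l.length - 1) (by omega)
      have h5 : l.length - 1 + 1 = l.length := by omega
      rw [h5, List.take_of_length_le hl'.le] at h4
      rw [h4]
      simp [nxt, h5]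

end Graph

/-! ### Refining φ so that it determines content and isolates letters. -/

section Refinement

variable {A S : Type} [Semigroup S] [Finite A]

/-- The homomorphism `φ` together with the content and the detection of letters. -/
noncomputable def refineHom (φ : OntoHom A S) :
    Pseudoword A →ₙ* S × (A → ZMod 2) × ZMod 4 :=
  -- In `ZMod 4` one has 2 · 2 = 0, so the constant valuation 2 tells single letters from longer
  -- words.
  φ.hom.prod ((evalHom fun a b => detect b a).prod (evalHom fun _ => 2))

/-- The refinement of `φ` that determines the content and separates the letters. -/
noncomputable def OntoHom.refine (φ : OntoHom A S) : OntoHom A (refineHom φ).srange where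
  hom := (refineHom φ).srangeRestrict
  surjective := (refineHom φ).srangeRestrict_surjective
  continuous := by
    let _ : TopologicalSpace S := ⊥
    have : DiscreteTopology S := ⟨rfl⟩
    let _ : TopologicalSpace (refineHom φ).srange := ⊥
    have : DiscreteTopology (refineHom φ).srange := ⟨rfl⟩
    rw [continuous_discrete_rng]
    intro b
    obtain ⟨x, rfl⟩ := (refineHom φ).srangeRestrict_surjective b
    have h1 : IsOpen {y | φ.hom y = φ.hom x} := (isOpen_discrete {φ.hom x}).preimage φ.continuous
    convert h1.inter ((isOpen_evalAt_eq (fun a b => detect b a) x).inter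
      (isOpen_evalAt_eq (fun _ => (2 : ZMod 4)) x)) using 1
    ext y
    rw [Set.mem_preimage, Set.mem_singleton_iff, Subtype.ext_iff]
    exact Prod.ext_iff.trans (and_congr_right fun _ => Prod.ext_iff)

theorem OntoHom.refine_eq {φ : OntoHom A S} {x y : Pseudoword A}
    (h : φ.refine.hom x = φ.refine.hom y) : φ.hom x = φ.hom y ∧
      content (x : WithOne (Pseudoword A)) = content (y : WithOne (Pseudoword A)) ∧
      evalAt x (fun _ => (2 : ZMod 4)) = evalAt y fun _ => (2 : ZMod 4) := by
  have h := Subtype.ext_iff.1 h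
  refine ⟨congrArg Prod.fst h, ?_, congrArg (fun z => z.2.2) h⟩
  have h2 : evalAt x (fun a b => detect b a) = evalAt y (fun a b => detect b a) :=
    congrArg (fun z => z.2.1) h
  ext b
  have h3 := fun z : Pseudoword A =>
    evalAt_comp (Pi.evalMulHom (fun _ : A => ZMod 2) b) z (fun a b => detect b a)
  exact Iff.of_eq (congrArg (· = 0) ((h3 x).trans ((congrArg _ h2).trans (h3 y).symm)))

theorem eq_letter_of_eval {x : Pseudoword A} {a : A}
    (hc : content (x : WithOne (Pseudoword A)) = {a})
    (h : evalAt x (fun _ => (2 : ZMod 4)) = 2) : x = letter a := by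
  refine pseudoword_ext fun T _ _ f => ?_
  obtain ⟨r, h1, h2⟩ := exists_word_content x fun a => (f a, (2 : ZMod 4))
  have h3 := lift_comp (MulHom.fst T (ZMod 4)) (fun a => (f a, (2 : ZMod 4))) r
  have h4 := lift_comp (MulHom.snd T (ZMod 4)) (fun a => (f a, (2 : ZMod 4))) r
  have h5 := evalAt_comp (MulHom.fst T (ZMod 4)) x (fun a => (f a, (2 : ZMod 4)))
  have h6 := evalAt_comp (MulHom.snd T (ZMod 4)) x (fun a => (f a, (2 : ZMod 4)))
  rw [h1, ← h5] at h3
  rw [h1, ← h6] at h4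
  have h3 : FreeSemigroup.lift f r = evalAt x f := h3
  have h4 : FreeSemigroup.lift (fun _ => (2 : ZMod 4)) r = 2 := h4.trans h
  rw [← h3, evalAt_letter]
  rw [hc] at h2
  clear h1 h3 h5 h6
  have hnil : ∀ r : FreeSemigroup A, 2 * FreeSemigroup.lift (fun _ => (2 : ZMod 4)) r = 0 := by
    intro r
    induction r with
    | ih1 i => rw [FreeSemigroup.lift_of]; decide
    | ih2 i r _ _ =>
      rw [map_mul, FreeSemigroup.lift_of, ← mul_assoc]
      exact mul_eq_zero_of_left (by decide) _
  induction r with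
  | ih1 b =>
    rw [wordContent_of, Set.singleton_eq_singleton_iff] at h2
    rw [FreeSemigroup.lift_of, h2]
  | ih2 i r _ _ =>
    rw [map_mul, FreeSemigroup.lift_of, hnil] at h4
    exact absurd h4 (by decide)

end Refinement

/-- Over H, `w i₀ * w i₀ = w i₀` closes the path based at `w i₀`. The replaced path has a fixed
point x, so x w' = x over H; cancellation makes w' idempotent over H, and the flag of `Approximable`
lifts this to DO ∩ H̄. -/
theorem exists_idempotent_family {A I S : Type} [Semigroup S] [Finite S] [Finite A] [Nonempty A]
    [Finite I] {H : FinSemigroupClass} {σ : ImplicitSignature} (hH : H.IsGroupPseudovariety)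
    (hσ : GraphReducible H σ) (φ : OntoHom A S) (i₀ : I) {w : I → Pseudoword A}
    (hw : Uniform (classDOBar H) w)
    (hidem : proj (classDOBar H) A (w i₀ * w i₀) = proj (classDOBar H) A (w i₀)) :
    ∃ w' : I → Pseudoword A, (∀ i, SigmaWord σ.addOmega A (w' i)) ∧
      (∀ i, φ.hom (w' i) = φ.hom (w i)) ∧ Uniform (classDOBar H) w' ∧
      proj (classDOBar H) A (w' i₀ * w' i₀) = proj (classDOBar H) A (w' i₀) := by
  have : Finite (refineHom φ).srange := inferInstance
  obtain ⟨l, h1, h2, h3⟩ := approximable_of_idempotent (σ := σ) (φ := φ.refine) hH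
    (fun x y h => (OntoHom.refine_eq h).2.1)
    (fun x a h => eq_letter_of_eval ((OntoHom.refine_eq h).2.1.trans (content_letter a))
      ((OntoHom.refine_eq h).2.2.trans (evalAt_letter a _)))
    (fun e he => hσ.exists_replacement hH φ.refine i₀ he) i₀ hw hidem
  obtain ⟨l', hl', x, hx⟩ := hσ.exists_closed_replacement hH φ.refine i₀ h1 (x := w i₀)
    ((h2 i₀ (w i₀)).symm.trans (proj_group_of_proj hH hidem))
  obtain ⟨w', a1, a2, a3, a4, a5⟩ := h3 l' hl'
  refine ⟨w', a1, fun i => (OntoHom.refine_eq (a2 i)).1, a3, a5 trivial i₀ ?_⟩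
  refine proj_left_cancel hH (x := x) ?_
  have h6 : proj H A (x * w' i₀) = proj H A x := (a4 i₀ x).trans hx
  rw [← mul_assoc, map_mul, h6, ← map_mul, h6]

end Pseudo

theorem corollaryc (H : Pseudo.FinSemigroupClass) (hH : H.IsGroupPseudovariety)
    (σ : Pseudo.ImplicitSignature) (hσ : Pseudo.GraphReducible H σ) :
    Pseudo.IdempotentPointlikeReducible (Pseudo.classDO.inter H.bar) σ.addOmega := by
  intro S _ _ P hP A _ _ φ
  obtain ⟨P', rfl, e, he, hP'⟩ := hP A φ
  have hw : ∀ s : φ.hom '' P', ∃ w ∈ P', φ.hom w = s := fun s => s.2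
  choose w hwP hws using hw
  have hwe : ∀ s, Pseudo.proj (Pseudo.classDOBar H) A (w s) = e := fun s => by
    have : Pseudo.proj (Pseudo.classDOBar H) A (w s) ∈ ({e} : Set _) :=
      hP' ▸ Set.mem_image_of_mem _ (hwP s)
    exact this
  obtain ⟨x, hx, -⟩ : e ∈ Pseudo.proj (Pseudo.classDOBar H) A '' P' := hP' ▸ rfl
  let i₀ : φ.hom '' P' := ⟨φ.hom x, x, hx, rfl⟩
  obtain ⟨w', h1, h2, h3, h4⟩ := Pseudo.exists_idempotent_family hH hσ φ i₀ (w := w)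
    (fun i j => (hwe i).trans (hwe j).symm) (by rw [map_mul, hwe, he.eq])
  refine ⟨Set.range w', ?_, ?_, Pseudo.proj (Pseudo.classDOBar H) A (w' i₀), ?_, ?_⟩
  · rintro _ ⟨i, rfl⟩
    exact h1 i
  · ext s
    constructor
    · rintro ⟨_, ⟨i, rfl⟩, rfl⟩
      rw [h2, hws]
      exact i.2
    · intro hs
      exact ⟨_, ⟨⟨s, hs⟩, rfl⟩, (h2 _).trans (hws _)⟩
  · unfold IsIdempotentElem
    rw [← map_mul, h4]
  · ext y
    constructor
    · rintro ⟨_, ⟨i, rfl⟩, rfl⟩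
      exact h3 i i₀
    · rintro rfl
      exact ⟨_, ⟨i₀, rfl⟩, rfl⟩
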